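/- **Setting.** Let $d\ge 1$ and let $A\in Sp(2d,\mathbb{Z})$ be such that $1$ is not an eigenvalue of $A$ and $A$ has an eigenvalue of modulus $>1$. Let $\lambda_{\max}=\sup\{\log|\beta| : \beta\in \mathrm{sp}(A)\}>0$, and let $J=\begin{pmatrix}0&-\mathrm{Id}\\ \mathrm{Id}&0\end{pmatrix}$. Fix a symplectic reduction of $A$ adapted to its Lyapunov exponents: numbers $0=\lambda_0<\lambda_1<\dots<\lambda_r$, dimensions $d_0\ge 0$, $d_1,\dots,d_r\ge 1$ with $d_0+\dots+d_r=d$, a matrix $A_0\in Sp(2d_0,\mathbb{R})$ whose eigenvalues have modulus $1$, matrices $D_i\in GL(d_i,\mathbb{R})$ whose eigenvalues have modulus $e^{\lambda_i}$ ($1\le i\le r$), and $Q\in Sp(2d,\mathbb{R})$ with $$A=Q\,(A_0\diamond A_1\diamond\cdots\diamond A_r)\,Q^{-1},\qquad A_i=\mathrm{diag}\big(D_i,(D_i^{T})^{-1}\big)\quad (1\le i\le r),$$ where $\diamond$ puts the position-position, position-momentum, momentum-position and momentum-momentum blocks of its factors each in block diagonal form. Let $\epsilon_0>0$ be fixed,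 and for $\hbar>0$ put $$B(\hbar)=Q\begin{pmatrix}D(\hbar)&0\\0&D(\hbar)\end{pmatrix}Q^{-1},\qquad D(\hbar)=\mathrm{diag}\Big(\hbar^{-\frac{\epsilon_0}{2\lambda_{\max}}}\mathrm{Id}_{\mathbb{R}^{d_0}},\hbar^{-\frac{\lambda_1}{2\lambda_{\max}}}\mathrm{Id}_{\mathbb{R}^{d_1}},\dots,\hbar^{-\frac{\lambda_r}{2\lambda_{\max}}}\mathrm{Id}_{\mathbb{R}^{d_r}}\Big),$$ $$G_\hbar(w)=2^{d/2}|\det B(\hbar)|^{1/2}\,e^{-\pi\|B(\hbar)w\|^2}\qquad (w\in\mathbb{R}^{2d}).$$ $\mathrm{Op}_\hbar^w$ is the Weyl quantization, $[\mathrm{Op}_\hbar^w(a)u](x)=(2\pi\hbar)^{-d}\int_{\mathbb{R}^{2d}}e^{\frac{i}{\hbar}\langle x-y,\xi\rangle}a\big(\tfrac{x+y}{2},\xi\big)u(y)\,dy\,d\xi$. Let $\Lambda_+=\sum_{i=0}^r d_i\lambda_i$. For even $n$, $A^{\pm n/2}$ are the integer powers. For odd $n$ the pair $(A^{n/2},A^{-n/2})$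 is read, by a choice made once and for all, either as $(A^{(n-1)/2},A^{-(n+1)/2})$, or as $(A^{(n+1)/2},A^{-(n-1)/2})$, or, for a fixed real symplectic matrix $R$ with $R^2=A$ (if there is one), as $(R^{n},R^{-n})$. The statement holds for each of these readings. **Proposition.** Let $0<\epsilon<1$. For every $\delta>0$ there is a constant $C$ such that, for all $0<\hbar\le 1$ and all $\rho,\rho',\rho_0,\rho_0'\in\mathbb{R}^{2d}$ (in particular for all representatives of points of $\mathbb{T}^{2d}=\mathbb{R}^{2d}/\mathbb{Z}^{2d}$), with $n=n_E(\hbar):=\big\lfloor(1-\epsilon)|\log\hbar|/\lambda_{\max}\big\rfloor$, the two Weyl quantizations below are bounded operators on $L^2(\mathbb{R}^d)$ and the product $$\mathrm{Op}_\hbar^w\Big(G_\hbar\big(A^{\frac n2}\bullet-\pi\hbar J\rho-\rho_0\big)e^{2i\pi\langle A^{\frac n2}\bullet-\rho_0,\rho\rangle}\Big)\;\mathrm{Op}_\hbar^w\Big(G_\hbar\big(A^{-\frac n2}\bullet-\pi\hbar J\rho'-\rho_0'\big)e^{2i\pi\langle A^{-\frac n2}\bullet-\rho_0',\rho'\rangle}\Big)^{*}$$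 has norm on $L^2(\mathbb{R}^d)$ at most $$C\,|\det B(\hbar)|\,\hbar^{-\delta-\epsilon\frac{\Lambda_+}{\lambda_{\max}}}\exp\Big(-\sum_{i:\,2\lambda_i-\lambda_{\max}>0}d_i\Big(\lambda_i-\frac{\lambda_{\max}}2\Big)n_E(\hbar)\Big).$$ -/

import Mathlib

open MeasureTheory

noncomputable section

namespace CatMap

/-- Phase space `ℝ^{2d} = ℝ^d × ℝ^d`, with points `(x, ξ) = Sum.elim x ξ`. -/
abbrev Phase (d : ℕ) : Type := Fin d ⊕ Fin d → ℝ

/-- `2d × 2d` matrices, written in `d × d` blocks. -/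
abbrev Mat (d : ℕ) (R : Type) : Type := Matrix (Fin d ⊕ Fin d) (Fin d ⊕ Fin d) R

/-- The Hilbert space `L²(ℝ^d, dx)`. -/
abbrev L2 (d : ℕ) : Type := Lp ℂ 2 (volume : Measure (Fin d → ℝ))

/-- The set of complex eigenvalues of a real square matrix. -/
def complexSpectrum {ι : Type} [Fintype ι] [DecidableEq ι] (M : Matrix ι ι ℝ) : Set ℂ :=
  spectrum ℂ (M.map (fun t : ℝ => (t : ℂ)))

/-- `λ_max`, the supremum of `log |β|` over the eigenvalues `β`. -/
def lamMax {d : ℕ} (A : Mat d ℝ) : ℝ :=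
  sSup ((fun β : ℂ => Real.log ‖β‖) '' complexSpectrum A)

/-- The diamond product `M_0 ⋄ M_1 ⋄ ⋯`: the four families of blocks (position-position,
position-momentum, momentum-position, momentum-momentum) are each put in block diagonal form. -/
def diamond {m : ℕ} {k : Fin m → ℕ}
    (M : ∀ i, Matrix (Fin (k i) ⊕ Fin (k i)) (Fin (k i) ⊕ Fin (k i)) ℝ) :
    Matrix ((Σ i, Fin (k i)) ⊕ (Σ i, Fin (k i))) ((Σ i, Fin (k i)) ⊕ (Σ i, Fin (k i))) ℝ :=
  Matrix.fromBlocks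
    (Matrix.blockDiagonal' fun i => (M i).toBlocks₁₁)
    (Matrix.blockDiagonal' fun i => (M i).toBlocks₁₂)
    (Matrix.blockDiagonal' fun i => (M i).toBlocks₂₁)
    (Matrix.blockDiagonal' fun i => (M i).toBlocks₂₂)

/-- A symplectic reduction of `A` adapted to its Oseledets decomposition: exponents
`0 = λ_0 < λ_1 < ⋯ < λ_r`, dimensions `d_0, …, d_r` of sum `d` (where `d_0 = 0` is allowed), and
`A = Q (A_0 ⋄ A_1 ⋄ ⋯ ⋄ A_r) Q⁻¹` with `Q` and `A_0` symplectic,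
`A_i = diag (D_i, (D_iᵀ)⁻¹)` for `1 ≤ i ≤ r`, the eigenvalues of `A_0` being of modulus `1` and
those of `D_i` of modulus `exp λ_i`. -/
structure OseledetsReduction {d : ℕ} (A : Mat d ℝ) where
  /-- the number of positive Lyapunov exponents -/
  r : ℕ
  /-- the dimensions `d_0, …, d_r` -/
  dim : Fin (r + 1) → ℕ
  sum_dim : ∑ i, dim i = d
  dim_pos : ∀ i, i ≠ 0 → 0 < dim i
  /-- the exponents `λ_0 = 0` and `λ_1, …, λ_r` -/
  lam : Fin (r + 1) → ℝ
  lam_zero : lam 0 = 0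
  lam_strictMono : StrictMono lam
  /-- the neutral block -/
  A0 : Mat (dim 0) ℝ
  A0_mem : A0 ∈ Matrix.symplecticGroup (Fin (dim 0)) ℝ
  A0_spec : ∀ z ∈ complexSpectrum A0, ‖z‖ = 1
  /-- the hyperbolic blocks `D_1, …, D_r` -/
  D : ∀ i : Fin r, Matrix (Fin (dim i.succ)) (Fin (dim i.succ)) ℝ
  D_isUnit : ∀ i, IsUnit (D i)
  D_spec : ∀ i, ∀ z ∈ complexSpectrum (D i), ‖z‖ = Real.exp (lam i.succ)
  /-- the symplectic change of basis -/
  Q : Mat d ℝ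
  Q_mem : Q ∈ Matrix.symplecticGroup (Fin d) ℝ
  eq_conj : A = Q *
    Matrix.reindex
      (Equiv.sumCongr (finSigmaFinEquiv.trans (finCongr sum_dim))
        (finSigmaFinEquiv.trans (finCongr sum_dim)))
      (Equiv.sumCongr (finSigmaFinEquiv.trans (finCongr sum_dim))
        (finSigmaFinEquiv.trans (finCongr sum_dim)))
      (diamond (k := dim)
        (Fin.cases A0 fun i => Matrix.fromBlocks (D i) 0 0 ((D i).transpose)⁻¹)) * Q⁻¹

namespace OseledetsReduction

variable {d : ℕ} {A : Mat d ℝ} (S : OseledetsReduction A)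

/-- The block `0 ≤ i ≤ r` to which a coordinate of `ℝ^d` belongs. -/
def blockOf (j : Fin d) : Fin (S.r + 1) :=
  ((finSigmaFinEquiv.trans (finCongr S.sum_dim)).symm j).1

/-- `γ_0 = ε_0 / (2 λ_max)` and `γ_i = λ_i / (2 λ_max)` for `i ≥ 1`. -/
def gam (ε₀ : ℝ) (i : Fin (S.r + 1)) : ℝ :=
  (if i = 0 then ε₀ else S.lam i) / (2 * lamMax A)

/-- `B(ħ) = Q diag (D_1(ħ), D_1(ħ)) Q⁻¹`, where `D_1(ħ)` is `ħ ^ (-γ_i)` on the `i`-th block. -/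
def B (ε₀ hbar : ℝ) : Mat d ℝ :=
  S.Q * Matrix.fromBlocks
    (Matrix.diagonal fun j => hbar ^ (-S.gam ε₀ (S.blockOf j))) 0
    0 (Matrix.diagonal fun j => hbar ^ (-S.gam ε₀ (S.blockOf j))) * S.Q⁻¹

/-- The adapted Gaussian `G_ħ = 2^{d/2} |det B(ħ)|^{1/2} G ∘ B(ħ)`, `G(w) = exp (-π ‖w‖²)`. -/
def gauss (ε₀ hbar : ℝ) (w : Phase d) : ℝ :=
  (2 : ℝ) ^ ((d : ℝ) / 2) * |(S.B ε₀ hbar).det| ^ (1 / 2 : ℝ) *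
    Real.exp (-Real.pi *
      ((S.B ε₀ hbar).mulVec w ⬝ᵥ (S.B ε₀ hbar).mulVec w))

/-- The symbol `w ↦ G_ħ (P w - π ħ J ρ - ρ₀) exp (2 i π ⟨P w - ρ₀, ρ⟩)`. -/
def symbol (ε₀ hbar : ℝ) (P : Mat d ℝ) (ρ ρ₀ : Phase d) (w : Phase d) : ℂ :=
  (S.gauss ε₀ hbar
      (P.mulVec w - (Real.pi * hbar) • (Matrix.J (Fin d) ℝ).mulVec ρ - ρ₀) : ℂ) *
    Complex.exp (2 * Complex.I * Real.pi * (((P.mulVec w - ρ₀) ⬝ᵥ ρ : ℝ) : ℂ))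

/-- `Λ_+ = ∑ d_i λ_i`. -/
def LamPlus : ℝ := ∑ i, (S.dim i : ℝ) * S.lam i

/-- The sum of `d_i (λ_i - λ_max / 2)` over the `i` with `2 λ_i - λ_max > 0`. -/
def rate : ℝ :=
  ∑ i with 0 < 2 * S.lam i - lamMax A, (S.dim i : ℝ) * (S.lam i - lamMax A / 2)

end OseledetsReduction

/-- The integrand `exp (i ⟨x - y, ξ⟩ / ħ) a((x + y) / 2, ξ) u(y)` of the Weyl quantization, at
`(y, ξ)`. -/
def weylIntegrand {d : ℕ} (hbar : ℝ) (a : Phase d → ℂ) (u : (Fin d → ℝ) → ℂ) (x : Fin d → ℝ)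
    (p : (Fin d → ℝ) × (Fin d → ℝ)) : ℂ :=
  Complex.exp (Complex.I / hbar * (((x - p.1) ⬝ᵥ p.2 : ℝ) : ℂ)) *
    a (Sum.elim ((1 / 2 : ℝ) • (x + p.1)) p.2) * u p.1

/-- The bounded operator `T` on `L²(ℝ^d)` is the Weyl quantization `Op_ħ^w(a)`: the defining
integral converges absolutely and gives `T u`, for every `u`. There is at most one such `T`. -/
def IsWeylQuantization {d : ℕ} (hbar : ℝ) (a : Phase d → ℂ) (T : L2 d →L[ℂ] L2 d) : Prop :=
  ∀ u : L2 d, ∀ᵐ x : Fin d → ℝ,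
    Integrable (weylIntegrand hbar a u x) ∧
    T u x = (1 / (2 * Real.pi * hbar : ℂ) ^ d) * ∫ p, weylIntegrand hbar a u x p

/-- The time `n_E(ħ) = [(1 - ε) |log ħ| / λ_max]`. -/
def nE {d : ℕ} (A : Mat d ℝ) (ε hbar : ℝ) : ℕ :=
  ⌊(1 - ε) * |Real.log hbar| / lamMax A⌋₊

/-- `P n` and `M n` stand for `A ^ (n / 2)` and `A ^ (-n / 2)`. For even `n` they are the integer
powers (in all three cases). For odd `n`, either the total time `n` is split into two integers
that differ by one, or a real symplectic square root of `A` is fixed and its powers are taken. -/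
def IsHalfPower {d : ℕ} (A : Mat d ℝ) (P M : ℕ → Mat d ℝ) : Prop :=
  (∀ n, P n = A ^ (n / 2) ∧ M n = A⁻¹ ^ (n - n / 2)) ∨
  (∀ n, P n = A ^ (n - n / 2) ∧ M n = A⁻¹ ^ (n / 2)) ∨
  ∃ R ∈ Matrix.symplecticGroup (Fin d) ℝ, R * R = A ∧ ∀ n, P n = R ^ n ∧ M n = R⁻¹ ^ n

end CatMap

end

/-! The Weyl operator of an integrable symbol is a superposition of phase-space reflections: up to
`(πħ)^{-d}` it is `∫ a(w) W(w) dw` composed with parity, where `W(w)` is the unitary translation by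
`2w`. In the product `T₊ T₋*` the parities cancel, leaving `X = S_f S_g*`. By the C*-identity `‖X‖²
= ‖S_f (S_g* S_g) S_f*‖`, and the Weyl relation turns both layers into superpositions of
translations weighted by ambiguity functions. Hence `‖X‖²` is at most a double integral of ambiguity
moduli (`enorm_sq_superpose_comp_adjoint_le`).

For Gaussian symbols these moduli are explicit Gaussians that see neither the centre nor the linear
phase (`ambiguity_gaussSymbol`); this gives uniformity in the points `ρ, ρ', ρ₀, ρ₀'`. As the half
powers are symplectic, a change of variables leaves a single integral, `overlap`, depending only on
`B(ħ)` and `N = Aⁿ`.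

In reduced coordinates rescaled by `ħ Q D`, with `D = diag(D(ħ), D(ħ))`, the exponent dominates a
constant times `|x|² + |y|² + ħ²|D²(y - 2Nx)|²`. On the positions of the `i`-th block with `i ≥ 1`,
`ħD²` is the scalar `ħ^{1-λ_i/λ_max} ≤ 1`, while the determinant of `N` there has modulus `e^{n d_i
λ_i}`. Since `n λ_max` is close to `(1-ε)|log ħ|`, the product has size `e^{(2λ_i-λ_max)n}` per
dimension up to losses governed by `ε`. The blocks with `2λ_i > λ_max` therefore shrink the
`x`-integral (`exists_overlap_le`, `inv_expansion_le`), and the square root gives the stated rate.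
-/

noncomputable section

/-! ### Weyl translations and parity on `L²`. -/

namespace CatMap

open Filter Topology Complex
open scoped InnerProductSpace ENNReal

variable {d : ℕ}

/-- The position component of a phase space point. -/
def pos (w : Phase d) : Fin d → ℝ := fun i => w (Sum.inl i)

/-- The momentum component of a phase space point. -/
def mom (w : Phase d) : Fin d → ℝ := fun i => w (Sum.inr i)

/-- The symplectic form on phase space. -/
def sform (w z : Phase d) : ℝ := mom w ⬝ᵥ pos z - pos w ⬝ᵥ mom z

lemma pos_add (w z : Phase d) : pos (w + z) = pos w + pos z := rfl
lemma mom_add (w z : Phase d) : mom (w + z) = mom w + mom z := rfl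
lemma pos_neg (w : Phase d) : pos (-w) = -pos w := rfl
lemma mom_neg (w : Phase d) : mom (-w) = -mom w := rfl

@[fun_prop]
lemma continuous_pos : Continuous (pos : Phase d → Fin d → ℝ) := by
  unfold pos; fun_prop

@[fun_prop]
lemma continuous_mom : Continuous (mom : Phase d → Fin d → ℝ) := by
  unfold mom; fun_prop

lemma sform_eq_dotProduct_J (w z : Phase d) :
    sform w z = w ⬝ᵥ (Matrix.J (Fin d) ℝ).mulVec z := by
  simp only [sform, Matrix.J, Matrix.fromBlocks_mulVec, dotProduct, Fintype.sum_sum_type, pos, mom]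
  simp [Matrix.neg_mulVec, Function.comp_def]
  ring

lemma sform_add_left (w w' z : Phase d) : sform (w + w') z = sform w z + sform w' z := by
  simp [sform, pos_add, mom_add, add_dotProduct]; ring

lemma sform_add_right (w z z' : Phase d) : sform w (z + z') = sform w z + sform w z' := by
  simp [sform, pos_add, mom_add, dotProduct_add]; ring

lemma sform_neg_left (w z : Phase d) : sform (-w) z = -sform w z := by
  simp [sform, pos_neg, mom_neg]; ring

lemma sform_neg_right (w z : Phase d) : sform w (-z) = -sform w z := by
  simp [sform, pos_neg, mom_neg]; ring

lemma sform_comm (w z : Phase d) : sform w z = -sform z w := by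
  simp [sform, dotProduct_comm]

lemma sform_self (w : Phase d) : sform w w = 0 := by
  simp [sform, dotProduct_comm]

@[fun_prop]
lemma continuous_sform {X : Type*} [TopologicalSpace X] {f g : X → Phase d}
    (hf : Continuous f) (hg : Continuous g) : Continuous fun x => sform (f x) (g x) := by
  unfold sform dotProduct pos mom; fun_prop

lemma norm_exp_I_mul_ofReal (r : ℝ) : ‖cexp (I * (r : ℂ))‖ = 1 := by
  rw [mul_comm, norm_exp_ofReal_mul_I]

lemma memLp_modulate (k : Fin d → ℝ) (c : ℝ) (u : L2 d) :
    MemLp (fun x : Fin d → ℝ => cexp (I * ((k ⬝ᵥ x + c : ℝ) : ℂ)) * u x) 2 volume := by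
  refine (Lp.memLp u).congr_norm ?_ (ae_of_all _ fun x => ?_)
  · refine AEStronglyMeasurable.mul (Continuous.aestronglyMeasurable ?_) (Lp.aestronglyMeasurable u)
    unfold dotProduct
    fun_prop
  · rw [norm_mul, norm_exp_I_mul_ofReal, one_mul]

/-- Multiplication by the character `exp (i (k ⬝ x + c))`. -/
def modulate (k : Fin d → ℝ) (c : ℝ) : L2 d →ₗᵢ[ℂ] L2 d where
  toFun u := (memLp_modulate k c u).toLp _
  map_add' u v := by
    rw [← MemLp.toLp_add, MemLp.toLp_eq_toLp_iff]
    filter_upwards [Lp.coeFn_add u v] with x hx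
    simp only [Pi.add_apply]
    rw [hx, Pi.add_apply, mul_add]
  map_smul' a u := by
    rw [RingHom.id_apply, ← MemLp.toLp_const_smul, MemLp.toLp_eq_toLp_iff]
    filter_upwards [Lp.coeFn_smul a u] with x hx
    simp only [Pi.smul_apply, smul_eq_mul]
    rw [hx, Pi.smul_apply, smul_eq_mul]
    ring
  norm_map' u := by
    simp only [LinearMap.coe_mk, AddHom.coe_mk]
    rw [Lp.norm_toLp, Lp.norm_def]
    congr 1
    refine eLpNorm_congr_norm_ae (ae_of_all _ fun x => ?_)
    rw [norm_mul, norm_exp_I_mul_ofReal, one_mul]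

lemma coeFn_modulate (k : Fin d → ℝ) (c : ℝ) (u : L2 d) :
    modulate k c u =ᵐ[volume] fun x => cexp (I * ((k ⬝ᵥ x + c : ℝ) : ℂ)) * u x :=
  (memLp_modulate k c u).coeFn_toLp

/-- Translation by `a` on `L²`. -/
def translate (a : Fin d → ℝ) : L2 d →ₗᵢ[ℂ] L2 d :=
  Lp.compMeasurePreservingₗᵢ ℂ (fun x => x - a) (measurePreserving_sub_right volume a)

lemma coeFn_translate (a : Fin d → ℝ) (u : L2 d) :
    translate a u =ᵐ[volume] fun x => u (x - a) :=
  Lp.coeFn_compMeasurePreserving u (measurePreserving_sub_right volume a)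

/-- The reflection `x ↦ -x` on `L²`. -/
def parity (d : ℕ) : L2 d →ₗᵢ[ℂ] L2 d :=
  Lp.compMeasurePreservingₗᵢ ℂ (fun x => -x) (Measure.measurePreserving_neg volume)

lemma coeFn_parity (u : L2 d) : parity d u =ᵐ[volume] fun x => u (-x) :=
  Lp.coeFn_compMeasurePreserving u (Measure.measurePreserving_neg volume)

lemma parity_parity (u : L2 d) : parity d (parity d u) = u := by
  refine Lp.ext ?_
  have h := (Measure.measurePreserving_neg (volume : Measure (Fin d → ℝ))).quasiMeasurePreserving.ae
    (coeFn_parity u)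
  filter_upwards [coeFn_parity (parity d u), h] with x h1 h2
  rw [h1, h2, neg_neg]

/-- The Weyl translation by `2 w` in phase space, with `t = 2 / ħ`. -/
def weyl (t : ℝ) (w : Phase d) : L2 d →ₗᵢ[ℂ] L2 d :=
  (modulate (t • mom w) (-(t * (mom w ⬝ᵥ pos w)))).comp (translate ((2 : ℝ) • pos w))

lemma coeFn_weyl (t : ℝ) (w : Phase d) (u : L2 d) :
    weyl t w u =ᵐ[volume] fun x =>
      cexp (I * ((t * (mom w ⬝ᵥ (x - pos w)) : ℝ) : ℂ)) * u (x - (2 : ℝ) • pos w) := by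
  filter_upwards [coeFn_modulate (t • mom w) (-(t * (mom w ⬝ᵥ pos w)))
    (translate ((2 : ℝ) • pos w) u), coeFn_translate ((2 : ℝ) • pos w) u] with x h1 h2
  refine h1.trans ?_
  rw [h2]
  congr 4
  rw [dotProduct_sub, smul_dotProduct, smul_eq_mul]
  ring

/-- The Weyl form of the canonical commutation relations. The cocycle is exactly `t · sform`,
without a factor, because `weyl t w` translates by `2w` and its phase is centred at the midpoint. -/
lemma weyl_weyl (t : ℝ) (w z : Phase d) (u : L2 d) :
    weyl t w (weyl t z u) = cexp (I * ((t * sform w z : ℝ) : ℂ)) • weyl t (w + z) u := by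
  refine Lp.ext ?_
  have h := (measurePreserving_sub_right (volume : Measure (Fin d → ℝ))
    ((2 : ℝ) • pos w)).quasiMeasurePreserving.ae (coeFn_weyl t z u)
  filter_upwards [coeFn_weyl t w (weyl t z u), h, coeFn_weyl t (w + z) u,
    Lp.coeFn_smul (cexp (I * ((t * sform w z : ℝ) : ℂ))) (weyl t (w + z) u)] with x h1 h2 h3 h4
  rw [h1, h2, h4, Pi.smul_apply, h3, smul_eq_mul, ← mul_assoc, ← mul_assoc, ← Complex.exp_add,
    ← Complex.exp_add]
  congr 2
  · rw [← mul_add, ← mul_add, ← ofReal_add, ← ofReal_add]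
    congr 2
    simp only [sform, pos_add, mom_add, dotProduct_sub, dotProduct_add, add_dotProduct,
      dotProduct_smul, smul_eq_mul]
    rw [dotProduct_comm (pos w) (mom z)]
    ring
  · rw [pos_add, smul_add, sub_sub]

lemma weyl_zero (t : ℝ) (u : L2 d) : weyl t (0 : Phase d) u = u := by
  refine Lp.ext ?_
  filter_upwards [coeFn_weyl t (0 : Phase d) u] with x h
  rw [h]
  have h1 : pos (0 : Phase d) = 0 := rfl
  have h2 : mom (0 : Phase d) = 0 := rfl
  simp [h1, h2]

lemma weyl_weyl_neg (t : ℝ) (w : Phase d) (u : L2 d) : weyl t w (weyl t (-w) u) = u := by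
  rw [weyl_weyl, sform_neg_right, sform_self]
  simp [weyl_zero]

lemma weyl_neg_weyl (t : ℝ) (w : Phase d) (u : L2 d) : weyl t (-w) (weyl t w u) = u := by
  simpa using weyl_weyl_neg t (-w) u

lemma inner_weyl_left (t : ℝ) (w : Phase d) (u v : L2 d) :
    ⟪weyl t w u, v⟫_ℂ = ⟪u, weyl t (-w) v⟫_ℂ := by
  rw [← (weyl t (-w)).inner_map_map (weyl t w u) v, weyl_neg_weyl]

lemma inner_parity_left (u v : L2 d) : ⟪parity d u, v⟫_ℂ = ⟪u, parity d v⟫_ℂ := by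
  rw [← (parity d).inner_map_map (parity d u) v, parity_parity]

/-- Strong continuity follows from weak continuity for isometries: `‖U_z u - U_{z₀} u‖² = 2‖u‖² - 2
Re ⟪U_z u, U_{z₀} u⟫`, and the inner product is continuous by dominated convergence. -/
lemma continuous_modulate_apply {X : Type*} [TopologicalSpace X] [FirstCountableTopology X]
    {k : X → Fin d → ℝ} {c : X → ℝ} (hk : Continuous k) (hc : Continuous c) (u : L2 d) :
    Continuous fun z => modulate (k z) (c z) u := by
  rw [continuous_iff_continuousAt]
  intro z₀
  have hin : Continuous fun z => ⟪modulate (k z) (c z) u, modulate (k z₀) (c z₀) u⟫_ℂ := by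
    have : (fun z => ⟪modulate (k z) (c z) u, modulate (k z₀) (c z₀) u⟫_ℂ) = fun z =>
        ∫ x, ⟪cexp (I * ((k z ⬝ᵥ x + c z : ℝ) : ℂ)) * u x,
          cexp (I * ((k z₀ ⬝ᵥ x + c z₀ : ℝ) : ℂ)) * u x⟫_ℂ := by
      funext z
      rw [L2.inner_def]
      refine integral_congr_ae ?_
      filter_upwards [coeFn_modulate (k z) (c z) u, coeFn_modulate (k z₀) (c z₀) u] with x h1 h2
      rw [h1, h2]
    rw [this]
    refine continuous_of_dominated (bound := fun x => ‖u x‖ ^ 2) ?_ ?_ ?_ ?_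
    · intro z
      exact (memLp_modulate _ _ u).1.inner (memLp_modulate _ _ u).1
    · intro z
      refine ae_of_all _ fun x => ?_
      refine (norm_inner_le_norm _ _).trans ?_
      rw [norm_mul, norm_mul, norm_exp_I_mul_ofReal, norm_exp_I_mul_ofReal, one_mul, sq]
    · exact (Lp.memLp u).integrable_norm_pow (by norm_num)
    · refine ae_of_all _ fun x => ?_
      refine Continuous.inner ?_ continuous_const
      unfold dotProduct
      fun_prop
  have hre : Tendsto (fun z => 2 * ‖u‖ ^ 2 -
      2 * RCLike.re ⟪modulate (k z) (c z) u, modulate (k z₀) (c z₀) u⟫_ℂ) (𝓝 z₀) (𝓝 0) := by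
    have h2 : Continuous fun z => 2 * ‖u‖ ^ 2 -
      2 * RCLike.re ⟪modulate (k z) (c z) u, modulate (k z₀) (c z₀) u⟫_ℂ :=
      continuous_const.sub (continuous_const.mul (RCLike.continuous_re.comp hin))
    have h3 := h2.tendsto z₀
    rwa [inner_self_eq_norm_sq, LinearIsometry.norm_map, sub_self] at h3
  rw [ContinuousAt, tendsto_iff_norm_sub_tendsto_zero]
  have h4 : (fun z => ‖modulate (k z) (c z) u - modulate (k z₀) (c z₀) u‖) = fun z =>
      √(2 * ‖u‖ ^ 2 - 2 * RCLike.re ⟪modulate (k z) (c z) u, modulate (k z₀) (c z₀) u⟫_ℂ) := by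
    funext z
    rw [← Real.sqrt_sq (norm_nonneg (_ - _)), @norm_sub_sq ℂ, LinearIsometry.norm_map,
      LinearIsometry.norm_map]
    congr 1
    ring
  rw [h4]
  simpa using hre.sqrt

lemma continuous_translate_apply {X : Type*} [TopologicalSpace X]
    {a : X → Fin d → ℝ} (ha : Continuous a) (u : L2 d) :
    Continuous fun z => translate (a z) u := by
  refine Continuous.compMeasurePreservingLp (f := fun _ => u)
    (g := fun z => (⟨fun x => x - a z, by fun_prop⟩ : C(Fin d → ℝ, Fin d → ℝ)))
    continuous_const ?_ (fun z => measurePreserving_sub_right volume (a z)) (by norm_num)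
  refine ContinuousMap.continuous_of_continuous_uncurry _ ?_
  simp only [Function.uncurry_def, ContinuousMap.coe_mk]
  fun_prop

lemma continuous_weyl_apply (t : ℝ) (u : L2 d) : Continuous fun w : Phase d => weyl t w u := by
  rw [continuous_iff_continuousAt]
  intro w₀
  set v := translate ((2 : ℝ) • pos w₀) u with hv
  have h1 : Continuous fun w : Phase d =>
      modulate (t • mom w) (-(t * (mom w ⬝ᵥ pos w))) v := by
    refine continuous_modulate_apply (by fun_prop) ?_ v
    unfold dotProduct mom pos
    fun_prop
  have h2 : Continuous fun w : Phase d => translate ((2 : ℝ) • pos w) u :=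
    continuous_translate_apply (by fun_prop) u
  -- The modulation also varies with `w`, but it is isometric, so the error made by freezing the
  -- translated function at `w₀` tends to zero.
  have h3 : Tendsto (fun w : Phase d => modulate (t • mom w) (-(t * (mom w ⬝ᵥ pos w)))
      (translate ((2 : ℝ) • pos w) u - v)) (𝓝 w₀) (𝓝 0) := by
    rw [tendsto_zero_iff_norm_tendsto_zero]
    simp only [LinearIsometry.norm_map]
    have := (h2.sub (continuous_const (y := v))).norm.tendsto w₀
    simpa [hv] using this
  have h4 := (h1.tendsto w₀).add h3
  rw [add_zero] at h4
  refine h4.congr fun w => ?_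
  rw [← map_add, add_sub_cancel]
  rfl

end CatMap

/-! ### Superpositions of translations and their ambiguity functions. -/

namespace CatMap

open Filter Topology Complex
open scoped InnerProductSpace ENNReal ComplexConjugate

variable {d : ℕ}

lemma integrable_smul_isometry {X : Type*} [MeasurableSpace X] {μ : Measure X}
    {f : X → ℂ} (hf : Integrable f μ) {v : X → L2 d} (hv : AEStronglyMeasurable v μ) {C : ℝ}
    (hC : ∀ w, ‖v w‖ ≤ C) : Integrable (fun w => f w • v w) μ := by
  refine (hf.norm.mul_const C).mono' (hf.1.smul hv) (ae_of_all _ fun w => ?_)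
  rw [norm_smul]
  exact mul_le_mul_of_nonneg_left (hC w) (norm_nonneg _)

lemma integrable_smul_weyl (t : ℝ) {f : Phase d → ℂ} (hf : Integrable f) (u : L2 d) :
    Integrable fun w => f w • weyl t w u :=
  integrable_smul_isometry hf (continuous_weyl_apply t u).aestronglyMeasurable
    fun w => ((weyl t w).norm_map u).le

lemma integrable_smul_weyl_neg (t : ℝ) {f : Phase d → ℂ} (hf : Integrable f) (u : L2 d) :
    Integrable fun w => f w • weyl t (-w) u :=
  integrable_smul_isometry hf
    ((continuous_weyl_apply t u).comp continuous_neg).aestronglyMeasurable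
    fun w => ((weyl t (-w)).norm_map u).le

/-- The superposition `∫ f(w) W(w) dw` of Weyl translations. -/
def superpose (t : ℝ) (f : Phase d → ℂ) (hf : Integrable f) : L2 d →L[ℂ] L2 d :=
  LinearMap.mkContinuous
    { toFun := fun u => ∫ w, f w • weyl t w u
      map_add' := fun u v => by
        simp only [map_add, smul_add]
        exact integral_add (integrable_smul_weyl t hf u) (integrable_smul_weyl t hf v)
      map_smul' := fun a u => by
        simp only [map_smul, RingHom.id_apply]
        rw [← integral_smul]
        exact integral_congr_ae (ae_of_all _ fun w => smul_comm _ _ _) }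
    (∫ w, ‖f w‖) fun u => by
      refine (norm_integral_le_integral_norm _).trans_eq ?_
      simp only [norm_smul, LinearIsometry.norm_map]
      exact integral_mul_const _ _

lemma superpose_apply (t : ℝ) {f : Phase d → ℂ} (hf : Integrable f) (u : L2 d) :
    superpose t f hf u = ∫ w, f w • weyl t w u := rfl

lemma integrable_conj {X : Type*} [MeasurableSpace X] {μ : Measure X} {f : X → ℂ}
    (hf : Integrable f μ) : Integrable (fun w => conj (f w)) μ :=
  (integrable_norm_iff (continuous_conj.comp_aestronglyMeasurable hf.1)).1
    (by simpa using hf.norm)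

lemma adjoint_superpose_apply (t : ℝ) {f : Phase d → ℂ} (hf : Integrable f) (u : L2 d) :
    ContinuousLinearMap.adjoint (superpose t f hf) u = ∫ w, conj (f w) • weyl t (-w) u := by
  refine ext_inner_left ℂ fun v => ?_
  have h1 := integrable_smul_weyl_neg t (integrable_conj hf) u
  rw [ContinuousLinearMap.adjoint_inner_right, ← integral_inner h1 v, superpose_apply,
    ← inner_conj_symm, ← integral_inner (integrable_smul_weyl t hf v) u, ← integral_conj]
  refine integral_congr_ae (ae_of_all _ fun w => ?_)
  simp only
  rw [inner_conj_symm, inner_smul_left, inner_smul_right, inner_weyl_left]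

lemma shear_measurePreserving :
    MeasurePreserving (fun p : Phase d × Phase d => (p.1, p.1 + p.2))
      (volume.prod volume) (volume.prod volume) :=
  measurePreserving_prod_add volume volume

/-- The shear `w = w' + m` collects all pairs that produce the same translation, so that
cancellation in the scalar coefficient survives when norms are taken in `m`. -/
lemma integral_integral_smul_sub {G : Phase d → Phase d → ℂ}
    (hG : Integrable (Function.uncurry G) (volume.prod volume)) {v : Phase d → L2 d}
    (hv : Continuous v) {C : ℝ} (hC : ∀ w, ‖v w‖ ≤ C) :
    ∫ w', ∫ w, G w' w • v (w - w') = ∫ m, (∫ w, G w (w + m)) • v m := by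
  have h1 : ∀ w', ∫ w, G w' w • v (w - w') = ∫ m, G w' (w' + m) • v m := by
    intro w'
    rw [← integral_add_left_eq_self _ w']
    simp
  simp_rw [h1]
  have h2 : Integrable (Function.uncurry fun w' m : Phase d => G w' (w' + m) • v m)
      (volume.prod volume) := by
    have := (shear_measurePreserving.integrable_comp hG.1).2 hG
    exact integrable_smul_isometry this (hv.comp continuous_snd).aestronglyMeasurable
      fun p => hC p.2
  rw [integral_integral_swap h2]
  refine integral_congr_ae (ae_of_all _ fun m => ?_)
  exact integral_smul_const _ _

lemma weyl_weyl_weyl_neg (t : ℝ) (w z w' : Phase d) (u : L2 d) :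
    weyl t w (weyl t z (weyl t (-w') u)) =
      cexp (I * ((t * (sform w z - sform (w + z) w') : ℝ) : ℂ)) • weyl t (w - w' + z) u := by
  rw [weyl_weyl, weyl_weyl, smul_smul, ← Complex.exp_add, sform_neg_right, ← mul_add, ← ofReal_add]
  rw [show w + z + -w' = w - w' + z by abel]
  congr 3
  ring_nf

/-- The modulus of the cross-ambiguity integral of `f`. -/
def ambiguity (t : ℝ) (f : Phase d → ℂ) (m v : Phase d) : ℝ≥0∞ :=
  ‖∫ w, f (w + m) * conj (f w) * cexp (I * ((t * sform w v : ℝ) : ℂ))‖ₑ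

lemma integrable_prod_phase {f g : Phase d → ℂ} (hf : Integrable f) (hg : Integrable g)
    {φ : Phase d × Phase d → ℝ} (hφ : Continuous φ) :
    Integrable (fun p : Phase d × Phase d => f p.1 * g p.2 * cexp (I * (φ p : ℂ)))
      (volume.prod volume) := by
  refine ((hf.mul_prod hg).norm).mono' ((hf.mul_prod hg).1.mul
    (Continuous.aestronglyMeasurable (by fun_prop))) (ae_of_all _ fun p => ?_)
  rw [norm_mul, norm_exp_I_mul_ofReal, mul_one]

lemma enorm_exp_I_mul_ofReal (r : ℝ) : ‖cexp (I * (r : ℂ))‖ₑ = 1 := by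
  rw [← ofReal_norm, norm_exp_I_mul_ofReal, ENNReal.ofReal_one]

/-- Two uses of the Weyl relation give a superposition of the unitaries `W(m + z)`. Its coefficient
is an ambiguity integral at `2z + m`, up to the unimodular factor `exp(i t sform m z)`, which is
free of `w`. -/
lemma enorm_superpose_weyl_adjoint_le (t : ℝ) {f : Phase d → ℂ} (hf : Integrable f) (z : Phase d)
    (u : L2 d) :
    ‖superpose t f hf (weyl t z (ContinuousLinearMap.adjoint (superpose t f hf) u))‖ₑ ≤
      (∫⁻ m, ambiguity t f m ((2 : ℝ) • z + m)) * ‖u‖ₑ := by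
  set G : Phase d → Phase d → ℂ := fun w' w => conj (f w') * f w *
    cexp (I * ((t * (sform w z - sform (w + z) w') : ℝ) : ℂ)) with hGdef
  have hG : Integrable (Function.uncurry G) (volume.prod volume) :=
    integrable_prod_phase (integrable_conj hf) hf
      (φ := fun p => t * (sform p.2 z - sform (p.2 + z) p.1)) (by fun_prop)
  have hv : Continuous fun w : Phase d => weyl t (w + z) u :=
    (continuous_weyl_apply t u).comp (by fun_prop)
  have h1 : superpose t f hf (weyl t z (ContinuousLinearMap.adjoint (superpose t f hf) u)) =
      ∫ w', ∫ w, G w' w • weyl t (w - w' + z) u := by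
    rw [superpose_apply, adjoint_superpose_apply]
    have h2 : ∀ w, f w • weyl t w (weyl t z (∫ w', conj (f w') • weyl t (-w') u)) =
        ∫ w', G w' w • weyl t (w - w' + z) u := by
      intro w
      have h3 := ((weyl t w).comp (weyl t z)).toContinuousLinearMap.integral_comp_comm
        (integrable_smul_weyl_neg t (integrable_conj hf) u)
      simp only [LinearIsometry.coe_toContinuousLinearMap, LinearIsometry.coe_comp,
        Function.comp_apply] at h3
      rw [← h3, ← integral_smul]
      refine integral_congr_ae (ae_of_all _ fun w' => ?_)
      simp only [map_smul, hGdef]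
      rw [weyl_weyl_weyl_neg, smul_smul, smul_smul]
      congr 1
      ring
    simp_rw [h2]
    refine integral_integral_swap ?_
    refine integrable_smul_isometry (C := ‖u‖) hG.swap (Continuous.aestronglyMeasurable ?_) ?_
    · exact hv.comp (continuous_fst.sub continuous_snd)
    · exact fun w => ((weyl t _).norm_map u).le
  rw [h1, integral_integral_smul_sub hG hv (C := ‖u‖) fun w => ((weyl t _).norm_map u).le]
  refine (enorm_integral_le_lintegral_enorm _).trans ?_
  rw [← lintegral_mul_const' _ _ enorm_ne_top]
  refine lintegral_mono fun m => ?_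
  rw [enorm_smul, (weyl t (m + z)).enorm_map]
  refine mul_le_mul_left (le_of_eq ?_) _
  rw [ambiguity, ← one_mul ‖∫ w, f (w + m) * _ * _‖ₑ, ← enorm_exp_I_mul_ofReal (t * sform m z),
    ← enorm_mul, ← integral_const_mul]
  congr 2
  funext w
  have : (t * (sform (w + m) z - sform (w + m + z) w) : ℝ) =
      t * sform m z + t * sform w ((2 : ℝ) • z + m) := by
    rw [two_smul]
    simp only [sform_add_left, sform_add_right, sform_self, sform_comm m w, sform_comm z w]
    ring
  simp only [hGdef]
  rw [this, ofReal_add, mul_add, Complex.exp_add]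
  ring

lemma adjoint_superpose_superpose_apply (t : ℝ) {f : Phase d → ℂ} (hf : Integrable f) (u : L2 d) :
    ContinuousLinearMap.adjoint (superpose t f hf) (superpose t f hf u) =
      ∫ m, (∫ w, f (w + m) * conj (f w) * cexp (I * ((t * sform w (-m) : ℝ) : ℂ))) •
        weyl t m u := by
  set G : Phase d → Phase d → ℂ := fun w' w => conj (f w') * f w *
    cexp (I * ((t * -sform w' w : ℝ) : ℂ)) with hGdef
  have hG : Integrable (Function.uncurry G) (volume.prod volume) :=
    integrable_prod_phase (integrable_conj hf) hf
      (φ := fun p => t * -sform p.1 p.2) (by fun_prop)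
  have h1 : ContinuousLinearMap.adjoint (superpose t f hf) (superpose t f hf u) =
      ∫ w', ∫ w, G w' w • weyl t (w - w') u := by
    rw [adjoint_superpose_apply, superpose_apply]
    refine integral_congr_ae (ae_of_all _ fun w' => ?_)
    have h3 := (weyl t (-w')).toContinuousLinearMap.integral_comp_comm
      (integrable_smul_weyl t hf u)
    simp only [LinearIsometry.coe_toContinuousLinearMap] at h3
    simp only
    rw [← h3, ← integral_smul]
    refine integral_congr_ae (ae_of_all _ fun w => ?_)
    simp only [map_smul, hGdef]
    rw [weyl_weyl, smul_smul, smul_smul, sform_neg_left, neg_add_eq_sub]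
  rw [h1, integral_integral_smul_sub hG (continuous_weyl_apply t u) (C := ‖u‖)
    fun w => ((weyl t _).norm_map u).le]
  refine integral_congr_ae (ae_of_all _ fun m => ?_)
  simp only
  congr 2
  funext w
  simp only [hGdef, sform_add_right, sform_self, sform_neg_right, zero_add]
  ring

/-- The norm of `S_f S_g^*` in terms of the ambiguity functions of `f` and `g`. -/
theorem enorm_sq_superpose_comp_adjoint_le (t : ℝ) {f g : Phase d → ℂ} (hf : Integrable f)
    (hg : Integrable g) :
    ‖superpose t f hf ∘L ContinuousLinearMap.adjoint (superpose t g hg)‖ₑ ^ 2 ≤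
      ∫⁻ m, ambiguity t g m (-m) * ∫⁻ m', ambiguity t f m' ((2 : ℝ) • m + m') := by
  set X := superpose t f hf ∘L ContinuousLinearMap.adjoint (superpose t g hg) with hX
  set R := ∫⁻ m, ambiguity t g m (-m) * ∫⁻ m', ambiguity t f m' ((2 : ℝ) • m + m') with hR
  by_cases hRtop : R = ∞
  · rw [hRtop]; exact le_top
  have hadj : ContinuousLinearMap.adjoint X =
      superpose t g hg ∘L ContinuousLinearMap.adjoint (superpose t f hf) := by
    rw [hX, ContinuousLinearMap.adjoint_comp, ContinuousLinearMap.adjoint_adjoint]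
  have happ : ∀ u, ‖(X ∘L ContinuousLinearMap.adjoint X) u‖ₑ ≤ R * ‖u‖ₑ := by
    intro u
    rw [hadj, hX]
    simp only [ContinuousLinearMap.comp_apply]
    rw [adjoint_superpose_superpose_apply]
    set v := ContinuousLinearMap.adjoint (superpose t f hf) u with hv
    by_cases hint : Integrable (fun m : Phase d => (∫ w, g (w + m) * conj (g w) *
        cexp (I * ((t * sform w (-m) : ℝ) : ℂ))) • weyl t m v)
    · rw [← (superpose t f hf).integral_comp_comm hint]
      refine (enorm_integral_le_lintegral_enorm _).trans ?_
      rw [hR, ← lintegral_mul_const' _ _ enorm_ne_top]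
      refine lintegral_mono fun m => ?_
      rw [map_smul, enorm_smul, mul_assoc]
      exact mul_le_mul_right (enorm_superpose_weyl_adjoint_le t hf m u) _
    -- Without integrability the Bochner integral takes the value `0`, for which the bound is
    -- trivial.
    · rw [integral_undef hint]
      simp
  have hnorm : ‖X ∘L ContinuousLinearMap.adjoint X‖ ≤ R.toReal := by
    refine ContinuousLinearMap.opNorm_le_bound _ ENNReal.toReal_nonneg fun u => ?_
    have := ENNReal.toReal_mono (ENNReal.mul_ne_top hRtop enorm_ne_top) (happ u)
    rwa [toReal_enorm, ENNReal.toReal_mul, toReal_enorm] at this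
  have hsq : ‖X‖ * ‖X‖ ≤ R.toReal := by
    have := CStarRing.norm_self_mul_star (x := X)
    rw [← this]
    exact hnorm
  rw [← ofReal_norm, ← ENNReal.ofReal_pow (norm_nonneg _), sq]
  exact ENNReal.ofReal_le_of_le_toReal hsq

end CatMap

/-! ### The Weyl quantization as a superposition of reflections. -/

namespace CatMap

open Filter Topology Complex
open scoped InnerProductSpace ENNReal ComplexConjugate

variable {d : ℕ}

/-- The Bochner integral of an `L²`-valued function is computed pointwise almost everywhere. -/
lemma coeFn_integral_L2 {X : Type*} [MeasurableSpace X] {μ : Measure X} [SFinite μ]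
    {F : X → L2 d} (hF : Integrable F μ) {Φ : X → (Fin d → ℝ) → ℂ}
    (hΦ : AEStronglyMeasurable (Function.uncurry Φ) (μ.prod volume))
    (h : ∀ w, F w =ᵐ[volume] Φ w) :
    ∀ᵐ x : Fin d → ℝ, Integrable (fun w => Φ w x) μ ∧ (∫ w, F w ∂μ) x = ∫ w, Φ w x ∂μ := by
  have key : ∀ s : Set (Fin d → ℝ), MeasurableSet s → volume s < ∞ →
      -- On a set of finite measure `L²` embeds in `L¹` with a norm bound, so Fubini applies there.
      -- Pairing with indicators then identifies the Bochner integral with the pointwise one.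
      Integrable (Function.uncurry Φ) (μ.prod (volume.restrict s)) := by
    intro s hs hμs
    have : IsFiniteMeasure ((volume : Measure (Fin d → ℝ)).restrict s) := ⟨by simpa using hμs⟩
    have hmeas : AEStronglyMeasurable (Function.uncurry Φ) (μ.prod (volume.restrict s)) :=
      hΦ.mono_ac (Measure.AbsolutelyContinuous.rfl.prod Measure.absolutelyContinuous_restrict)
    rw [integrable_prod_iff hmeas]
    refine ⟨ae_of_all _ fun w => ?_, ?_⟩
    · exact (integrableOn_Lp_of_measure_ne_top (F w) (by norm_num) hμs.ne).congr
        (ae_restrict_of_ae (h w))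
    · set c : ℝ := ((volume.restrict s) (Set.univ : Set (Fin d → ℝ)) ^
        (1 / (1 : ℝ≥0∞).toReal - 1 / (2 : ℝ≥0∞).toReal)).toReal
      refine (hF.norm.mul_const c).mono' hmeas.norm.integral_prod_right' (ae_of_all _ fun w => ?_)
      rw [Real.norm_of_nonneg (integral_nonneg fun _ => norm_nonneg _)]
      have h1 : ∫ x in s, ‖Function.uncurry Φ (w, x)‖ = ∫ x in s, ‖F w x‖ := by
        refine integral_congr_ae ?_
        filter_upwards [ae_restrict_of_ae (h w)] with x hx
        rw [hx]; rfl
      have hae : AEStronglyMeasurable (F w) (volume.restrict s) :=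
        (Lp.aestronglyMeasurable (F w)).restrict
      have h2 := eLpNorm_le_eLpNorm_mul_rpow_measure_univ (μ := volume.restrict s)
        (one_le_two : (1 : ℝ≥0∞) ≤ 2) hae
      have h3 : eLpNorm (F w) 2 (volume.restrict s) ≤ eLpNorm (F w) 2 volume :=
        eLpNorm_restrict_le _ _ _ _
      have h4 := h2.trans (mul_le_mul_left h3 _)
      rw [h1, integral_norm_eq_lintegral_enorm hae, ← eLpNorm_one_eq_lintegral_enorm, Lp.norm_def,
        ← ENNReal.toReal_mul]
      refine ENNReal.toReal_mono (ENNReal.mul_ne_top (Lp.eLpNorm_ne_top (F w)) ?_) h4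
      refine ENNReal.rpow_ne_top_of_nonneg (by norm_num) (measure_ne_top _ _)
  have h1 : ∀ᵐ x : Fin d → ℝ, Integrable (fun w => Φ w x) μ := by
    have h2 : ∀ n, ∀ᵐ x : Fin d → ℝ, x ∈ spanningSets volume n → Integrable (fun w => Φ w x) μ := by
      intro n
      rw [← ae_restrict_iff' (measurableSet_spanningSets volume n)]
      exact (key _ (measurableSet_spanningSets volume n)
        (measure_spanningSets_lt_top volume n)).prod_left_ae
    filter_upwards [ae_all_iff.2 h2] with x hx
    exact hx _ (mem_spanningSetsIndex volume x)
  have h2 : (fun x => (∫ w, F w ∂μ) x) =ᵐ[volume] fun x => ∫ w, Φ w x ∂μ := by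
    refine ae_eq_of_forall_setIntegral_eq_of_sigmaFinite ?_ ?_ ?_
    · intro s hs hμs
      exact integrableOn_Lp_of_measure_ne_top _ (by norm_num) hμs.ne
    · intro s hs hμs
      exact (key s hs hμs).integral_prod_right
    · intro s hs hμs
      rw [← L2.inner_indicatorConstLp_one (𝕜 := ℂ) hs hμs.ne, ← integral_inner hF,
        ← integral_integral_swap (key s hs hμs)]
      refine integral_congr_ae (ae_of_all _ fun w => ?_)
      simp only
      rw [L2.inner_indicatorConstLp_one hs hμs.ne]
      exact integral_congr_ae (ae_restrict_of_ae (h w))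
  filter_upwards [h1, h2] with x hx1 hx2
  exact ⟨hx1, hx2⟩

/-- The Weyl quantization of an integrable symbol, as a superposition of reflections. -/
def weylOp (hbar : ℝ) (a : Phase d → ℂ) (ha : Integrable a) : L2 d →L[ℂ] L2 d :=
  ((1 / (Real.pi * hbar : ℝ) ^ d : ℝ) : ℂ) •
    (superpose (2 / hbar) a ha ∘L (parity d).toContinuousLinearMap)

lemma map_two_smul_sub (x : Fin d → ℝ) :
    Measure.map (fun X : Fin d → ℝ => (2 : ℝ) • X - x) volume =
      ENNReal.ofReal ((2 : ℝ) ^ d)⁻¹ • (volume : Measure (Fin d → ℝ)) := by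
  have h1 : (fun X : Fin d → ℝ => (2 : ℝ) • X - x) = (fun X => X - x) ∘ fun X => (2 : ℝ) • X := rfl
  rw [h1, ← Measure.map_map (by fun_prop) (by fun_prop), Measure.map_addHaar_smul _ two_ne_zero,
    Measure.map_smul, (measurePreserving_sub_right volume x).map_eq]
  simp [abs_of_pos]

/-- The change of variables `(X, ξ) ↦ (2 X - x, ξ)`. -/
def reflectHomeo (x : Fin d → ℝ) : Phase d ≃ᵐ (Fin d → ℝ) × (Fin d → ℝ) :=
  (MeasurableEquiv.sumPiEquivProdPi fun _ : Fin d ⊕ Fin d => ℝ).trans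
    (MeasurableEquiv.prodCongr
      ((Homeomorph.smulOfNeZero (2 : ℝ) two_ne_zero).trans (Homeomorph.subRight x)).toMeasurableEquiv
      (MeasurableEquiv.refl _))

lemma reflectHomeo_apply (x : Fin d → ℝ) (w : Phase d) :
    reflectHomeo x w = ((2 : ℝ) • pos w - x, mom w) := rfl

lemma map_reflectHomeo (x : Fin d → ℝ) :
    Measure.map (reflectHomeo x) volume =
      ENNReal.ofReal ((2 : ℝ) ^ d)⁻¹ •
        (volume : Measure ((Fin d → ℝ) × (Fin d → ℝ))) := by
  have h1 : (reflectHomeo x : Phase d → _) =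
      (Prod.map (fun X : Fin d → ℝ => (2 : ℝ) • X - x) id) ∘
        (MeasurableEquiv.sumPiEquivProdPi fun _ : Fin d ⊕ Fin d => ℝ) := rfl
  rw [h1, ← Measure.map_map (by fun_prop) (MeasurableEquiv.measurable _),
    (volume_measurePreserving_sumPiEquivProdPi fun _ : Fin d ⊕ Fin d => ℝ).map_eq,
    Measure.volume_eq_prod, ← Measure.map_prod_map _ _ (by fun_prop) measurable_id,
    map_two_smul_sub, Measure.map_id, Measure.prod_smul_left]

/-- With the midpoint `X = (x + y)/2` as variable, the kernel acts at fixed `(X, ξ)` as the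
reflection `x ↦ 2X - x` with a phase, that is, as a Weyl translation after parity. -/
lemma weylIntegrand_reflectHomeo (hbar : ℝ) (a : Phase d → ℂ) (u : (Fin d → ℝ) → ℂ)
    (x : Fin d → ℝ) (w : Phase d) :
    weylIntegrand hbar a u x (reflectHomeo x w) =
      a w * (cexp (I * ((2 / hbar * (mom w ⬝ᵥ (x - pos w)) : ℝ) : ℂ)) *
        u ((2 : ℝ) • pos w - x)) := by
  rw [reflectHomeo_apply, weylIntegrand]
  simp only
  have h1 : (Sum.elim ((1 / 2 : ℝ) • (x + ((2 : ℝ) • pos w - x))) (mom w) : Phase d) = w := by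
    rw [add_sub_cancel, smul_smul]
    norm_num
    funext i
    cases i <;> rfl
  have h2 : (x - ((2 : ℝ) • pos w - x)) ⬝ᵥ mom w = 2 * (mom w ⬝ᵥ (x - pos w)) := by
    rw [dotProduct_comm, ← smul_eq_mul, ← dotProduct_smul]
    congr 1
    module
  rw [h1, h2]
  push_cast
  ring_nf

theorem isWeylQuantization_weylOp (hbar : ℝ) {a : Phase d → ℂ}
    (ha : Integrable a) : IsWeylQuantization hbar a (weylOp hbar a ha) := by
  intro u
  set Φ : Phase d → (Fin d → ℝ) → ℂ := fun w x =>
    a w * (cexp (I * ((2 / hbar * (mom w ⬝ᵥ (x - pos w)) : ℝ) : ℂ)) *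
        u ((2 : ℝ) • pos w - x)) with hΦdef
  have hΦ : AEStronglyMeasurable (Function.uncurry Φ) (volume.prod volume) := by
    refine ha.1.comp_fst.mul (AEStronglyMeasurable.mul ?_ ?_)
    · refine Continuous.aestronglyMeasurable ?_
      unfold dotProduct
      simp only [mom]
      fun_prop
    · refine ((Lp.stronglyMeasurable u).comp_measurable ?_).aestronglyMeasurable
      exact Continuous.measurable (by fun_prop)
  have hF : ∀ w, a w • weyl (2 / hbar) w (parity d u) =ᵐ[volume] Φ w := by
    intro w
    have h := (measurePreserving_sub_right (volume : Measure (Fin d → ℝ))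
      ((2 : ℝ) • pos w)).quasiMeasurePreserving.ae (coeFn_parity u)
    filter_upwards [Lp.coeFn_smul (a w) (weyl (2 / hbar) w (parity d u)),
      coeFn_weyl (2 / hbar) w (parity d u), h] with x h1 h2 h3
    rw [h1, Pi.smul_apply, h2, h3, neg_sub, smul_eq_mul]
  filter_upwards [coeFn_integral_L2 (integrable_smul_weyl (2 / hbar) ha (parity d u)) hΦ hF,
    Lp.coeFn_smul ((1 / (Real.pi * hbar : ℝ) ^ d : ℝ) : ℂ)
      (superpose (2 / hbar) a ha (parity d u))] with x hx hx2
  have h2d : (0 : ℝ) < ((2 : ℝ) ^ d)⁻¹ := by positivity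
  have hint : Integrable (weylIntegrand hbar a u x ∘ reflectHomeo x) := by
    refine hx.1.congr (ae_of_all _ fun w => ?_)
    exact (weylIntegrand_reflectHomeo hbar a u x w).symm
  have hval : ∫ w, Φ w x = ((2 : ℝ) ^ d)⁻¹ • ∫ p, weylIntegrand hbar a u x p := by
    have h1 : ∫ w, Φ w x = ∫ w, weylIntegrand hbar a u x (reflectHomeo x w) :=
      integral_congr_ae (ae_of_all _ fun w => (weylIntegrand_reflectHomeo hbar a u x w).symm)
    -- The Jacobian `2^{-d}` accounts for the passage from the normalization `(2πħ)^{-d}` to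
    -- `(πħ)^{-d}` in `weylOp`.
    rw [h1, ← integral_map_equiv, map_reflectHomeo, integral_smul_measure,
      ENNReal.toReal_ofReal h2d.le]
  constructor
  · rw [← integrable_map_equiv, map_reflectHomeo,
      integrable_smul_measure (by simp) ENNReal.ofReal_ne_top] at hint
    exact hint
  · refine hx2.trans ?_
    rw [Pi.smul_apply, superpose_apply, hx.2, hval, smul_eq_mul, real_smul, ← mul_assoc]
    congr 1
    push_cast
    rw [mul_pow, mul_pow, mul_pow]
    field_simp

end CatMap

/-! ### Gaussian symbols and reduction to one Gaussian integral. -/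

namespace CatMap

open Filter Topology Complex
open scoped InnerProductSpace ENNReal ComplexConjugate Matrix

variable {d : ℕ}

section LinearChange

variable {ι : Type*} [Fintype ι]

lemma real_dotProduct_self_nonneg (v : ι → ℝ) : 0 ≤ v ⬝ᵥ v :=
  Finset.sum_nonneg fun i _ => mul_self_nonneg (v i)

lemma integrable_gaussian {b : ℝ} (hb : 0 < b) :
    Integrable fun y : ι → ℝ => ((Real.exp (-b * (y ⬝ᵥ y)) : ℝ) : ℂ) := by
  refine (GaussianFourier.integrable_cexp_neg_mul_sum_add (b := (b : ℂ)) (by simpa using hb)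
    (0 : ι → ℂ)).congr (ae_of_all _ fun y => ?_)
  simp [dotProduct, sq]

lemma lintegral_gaussian_lt_top {b : ℝ} (hb : 0 < b) :
    ∫⁻ y : ι → ℝ, ENNReal.ofReal (Real.exp (-b * (y ⬝ᵥ y))) < ∞ := by
  have := (integrable_gaussian (ι := ι) hb).2
  refine lt_of_eq_of_lt (lintegral_congr fun y => ?_) this
  rw [← ofReal_norm, norm_real, Real.norm_of_nonneg (Real.exp_pos _).le]

lemma integral_gaussian_mul_cexp {b : ℝ} (hb : 0 < b) (p : ι → ℝ) :
    ∫ y : ι → ℝ, ((Real.exp (-b * (y ⬝ᵥ y)) : ℝ) : ℂ) * cexp (I * ((y ⬝ᵥ p : ℝ) : ℂ)) =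
      (((Real.pi / b) ^ (Fintype.card ι / 2 : ℝ) * Real.exp (-(p ⬝ᵥ p) / (4 * b)) : ℝ) : ℂ) := by
  have h := GaussianFourier.integral_cexp_neg_mul_sum_add (b := (b : ℂ)) (by simpa using hb)
    (fun i : ι => I * (p i : ℂ))
  have h1 : (fun y : ι → ℝ => ((Real.exp (-b * (y ⬝ᵥ y)) : ℝ) : ℂ) *
      cexp (I * ((y ⬝ᵥ p : ℝ) : ℂ))) = fun y : ι → ℝ =>
      cexp (-(b : ℂ) * ∑ i, (y i : ℂ) ^ 2 + ∑ i, I * (p i : ℂ) * (y i : ℂ)) := by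
    funext y
    rw [Complex.exp_add, ofReal_exp]
    congr 2
    · simp [dotProduct, sq]
    · simp only [dotProduct, ofReal_sum, ofReal_mul, Finset.mul_sum]
      exact Finset.sum_congr rfl fun i _ => by ring
  rw [h1, h, ofReal_mul, ofReal_cpow (by positivity)]
  congr 1
  · push_cast; rfl
  · rw [ofReal_exp]
    congr 1
    simp only [mul_pow, I_sq, dotProduct]
    push_cast
    simp only [neg_mul, one_mul, Finset.sum_neg_distrib, sq]

variable [DecidableEq ι]

/-- An invertible matrix as a measurable equivalence. -/
def mulVecEquiv (L : Matrix ι ι ℝ) (hL : L.det ≠ 0) : (ι → ℝ) ≃ᵐ (ι → ℝ) where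
  toFun := L.mulVec
  invFun := L⁻¹.mulVec
  left_inv w := by
    rw [Matrix.mulVec_mulVec, Matrix.nonsing_inv_mul _ (Ne.isUnit hL), Matrix.one_mulVec]
  right_inv w := by
    rw [Matrix.mulVec_mulVec, Matrix.mul_nonsing_inv _ (Ne.isUnit hL), Matrix.one_mulVec]
  measurable_toFun := (Continuous.matrix_mulVec continuous_const continuous_id).measurable
  measurable_invFun := (Continuous.matrix_mulVec continuous_const continuous_id).measurable

lemma map_mulVecEquiv (L : Matrix ι ι ℝ) (hL : L.det ≠ 0) :
    Measure.map (mulVecEquiv L hL) volume = ENNReal.ofReal |L.det|⁻¹ • volume := by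
  rw [← abs_inv]
  exact Real.map_matrix_volume_pi_eq_smul_volume_pi hL

lemma lintegral_comp_mulVec (L : Matrix ι ι ℝ) (hL : L.det ≠ 0) (g : (ι → ℝ) → ℝ≥0∞) :
    ∫⁻ w, g (L.mulVec w) = ENNReal.ofReal |L.det|⁻¹ * ∫⁻ w, g w := by
  have := lintegral_map_equiv (μ := volume) g (mulVecEquiv L hL)
  rw [map_mulVecEquiv, lintegral_smul_measure] at this
  exact this.symm

lemma lintegral_eq_mul_comp_mulVec (L : Matrix ι ι ℝ) (hL : L.det ≠ 0) (g : (ι → ℝ) → ℝ≥0∞) :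
    ∫⁻ w, g w = ENNReal.ofReal |L.det| * ∫⁻ w, g (L.mulVec w) := by
  rw [lintegral_comp_mulVec L hL, ← mul_assoc, ← ENNReal.ofReal_mul (abs_nonneg _),
    mul_inv_cancel₀ (abs_ne_zero.2 hL), ENNReal.ofReal_one, one_mul]

lemma integral_comp_mulVec (L : Matrix ι ι ℝ) (hL : L.det ≠ 0) (g : (ι → ℝ) → ℂ) :
    ∫ w, g (L.mulVec w) = (|L.det|⁻¹ : ℝ) • ∫ w, g w := by
  have := integral_map_equiv (μ := volume) (mulVecEquiv L hL) g
  rw [map_mulVecEquiv, integral_smul_measure, ENNReal.toReal_ofReal (by positivity)] at this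
  exact this.symm

lemma integrable_comp_mulVec (L : Matrix ι ι ℝ) (hL : L.det ≠ 0) {g : (ι → ℝ) → ℂ}
    (hg : Integrable g) : Integrable fun w => g (L.mulVec w) := by
  have := integrable_map_equiv (μ := volume) (mulVecEquiv L hL) g
  rw [map_mulVecEquiv] at this
  exact this.1 (hg.smul_measure ENNReal.ofReal_ne_top)

end LinearChange

lemma J_det_ne_zero : (Matrix.J (Fin d) ℝ).det ≠ 0 := (Matrix.isUnit_det_J (Fin d) ℝ).ne_zero

/-- A modulated Gaussian symbol. -/
def gaussSymbol (k : ℝ) (L : Mat d ℝ) (s : Phase d) (φ : Phase d → ℝ) (w : Phase d) : ℂ :=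
  ((k * Real.exp (-Real.pi * ((L *ᵥ w - s) ⬝ᵥ (L *ᵥ w - s))) : ℝ) : ℂ) * cexp (I * (φ w : ℂ))

lemma integrable_gaussSymbol (k : ℝ) {L : Mat d ℝ} (hL : L.det ≠ 0) (s : Phase d)
    {φ : Phase d → ℝ} (hφ : Continuous φ) : Integrable (gaussSymbol k L s φ) := by
  have h1 := (integrable_comp_mulVec L hL
    ((integrable_gaussian (ι := Fin d ⊕ Fin d) Real.pi_pos).comp_sub_right s)).const_mul (k : ℂ)
  refine h1.norm.mono' (Continuous.aestronglyMeasurable ?_) (ae_of_all _ fun w => ?_)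
  · unfold gaussSymbol
    have : Continuous fun w : Phase d => L *ᵥ w - s :=
      (Continuous.matrix_mulVec continuous_const continuous_id).sub continuous_const
    have h2 : Continuous fun w : Phase d => (L *ᵥ w - s) ⬝ᵥ (L *ᵥ w - s) := this.dotProduct this
    fun_prop
  · rw [gaussSymbol, norm_mul, norm_exp_I_mul_ofReal, mul_one, ofReal_mul]

/-- The parallelogram identity recentres the two Gaussians at `s - Lm/2` and splits off
`exp(-π|Lm|²/2)`; the Fourier transform of the remaining Gaussian gives the last factor. Since the
phase increment `ψ m` does not depend on `w`, phase and centre enter only through unimodular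
constants. -/
lemma ambiguity_gaussSymbol (t k : ℝ) {L : Mat d ℝ} (hL : L.det ≠ 0) (s : Phase d)
    {φ ψ : Phase d → ℝ} (hφ : ∀ w m, φ (w + m) = φ w + ψ m)
    (m v : Phase d) :
    ambiguity t (gaussSymbol k L s φ) m v =
      ENNReal.ofReal (k ^ 2 * |L.det|⁻¹ * (1 / 2) ^ d *
        Real.exp (-(Real.pi / 2) * ((L *ᵥ m) ⬝ᵥ (L *ᵥ m))) *
        Real.exp (-(t ^ 2 / (8 * Real.pi)) *
          (((L⁻¹)ᵀ *ᵥ (Matrix.J (Fin d) ℝ *ᵥ v)) ⬝ᵥ ((L⁻¹)ᵀ *ᵥ (Matrix.J (Fin d) ℝ *ᵥ v))))) := by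
  set p : Phase d := (L⁻¹)ᵀ *ᵥ (Matrix.J (Fin d) ℝ *ᵥ v) with hp
  set s' : Phase d := s - (1 / 2 : ℝ) • (L *ᵥ m) with hs'
  set K : ℝ := k ^ 2 * Real.exp (-(Real.pi / 2) * ((L *ᵥ m) ⬝ᵥ (L *ᵥ m))) with hK
  set F : Phase d → ℂ := fun y =>
    ((Real.exp (-(2 * Real.pi) * ((y - s') ⬝ᵥ (y - s'))) : ℝ) : ℂ) *
      cexp (I * (((y - s') ⬝ᵥ (t • p) : ℝ) : ℂ)) with hF
  have hpt : ∀ w, gaussSymbol k L s φ (w + m) * conj (gaussSymbol k L s φ w) *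
      cexp (I * ((t * sform w v : ℝ) : ℂ)) =
      (K * cexp (I * (ψ m + t * (s' ⬝ᵥ p) : ℝ))) * F (L *ᵥ w) := by
    intro w
    have hsf : sform w v = (L *ᵥ w) ⬝ᵥ p := by
      rw [sform_eq_dotProduct_J, hp]
      generalize Matrix.J (Fin d) ℝ *ᵥ v = q
      rw [Matrix.dotProduct_mulVec, Matrix.vecMul_transpose, Matrix.mulVec_mulVec, Matrix.nonsing_inv_mul _ (Ne.isUnit hL), Matrix.one_mulVec]
    have hq : -Real.pi * ((L *ᵥ (w + m) - s) ⬝ᵥ (L *ᵥ (w + m) - s)) +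
        -Real.pi * ((L *ᵥ w - s) ⬝ᵥ (L *ᵥ w - s)) =
        -(Real.pi / 2) * ((L *ᵥ m) ⬝ᵥ (L *ᵥ m)) +
          -(2 * Real.pi) * ((L *ᵥ w - s') ⬝ᵥ (L *ᵥ w - s')) := by
      rw [hs', Matrix.mulVec_add]
      generalize L *ᵥ w = x
      generalize L *ᵥ m = y
      simp only [dotProduct_sub, sub_dotProduct, dotProduct_add, add_dotProduct, dotProduct_smul,
        smul_dotProduct, smul_eq_mul, dotProduct_comm y x, dotProduct_comm s x,
        dotProduct_comm s y]
      ring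
    have hph : φ (w + m) + -φ w + t * sform w v =
        ψ m + t * (s' ⬝ᵥ p) + (L *ᵥ w - s') ⬝ᵥ (t • p) := by
      rw [hφ, hsf, dotProduct_smul, sub_dotProduct (L *ᵥ w) s' p, smul_eq_mul]
      ring
    have hK' : (K : ℂ) * ((Real.exp (-(2 * Real.pi) * ((L *ᵥ w - s') ⬝ᵥ (L *ᵥ w - s'))) : ℝ) : ℂ) =
        ((k * Real.exp (-Real.pi * ((L *ᵥ (w + m) - s) ⬝ᵥ (L *ᵥ (w + m) - s))) : ℝ) : ℂ) *
        ((k * Real.exp (-Real.pi * ((L *ᵥ w - s) ⬝ᵥ (L *ᵥ w - s))) : ℝ) : ℂ) := by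
      rw [← ofReal_mul, ← ofReal_mul, hK, mul_assoc, ← Real.exp_add, ← hq, Real.exp_add]
      congr 1
      ring
    have hconj : conj (cexp (I * (φ w : ℂ))) = cexp (I * ((-φ w : ℝ) : ℂ)) := by
      rw [← exp_conj]
      congr 1
      simp
    simp only [gaussSymbol, map_mul, conj_ofReal, hconj, hF]
    have hE : cexp (I * (φ (w + m) : ℂ)) * cexp (I * ((-φ w : ℝ) : ℂ)) *
        cexp (I * ((t * sform w v : ℝ) : ℂ)) =
        cexp (I * ((ψ m + t * (s' ⬝ᵥ p) : ℝ) : ℂ)) *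
          cexp (I * (((L *ᵥ w - s') ⬝ᵥ (t • p) : ℝ) : ℂ)) := by
      rw [← Complex.exp_add, ← Complex.exp_add, ← Complex.exp_add, ← mul_add, ← mul_add,
        ← mul_add, ← ofReal_add, ← ofReal_add, ← ofReal_add, hph]
    linear_combination (exp := 1)
      ((k * Real.exp (-Real.pi * ((L *ᵥ (w + m) - s) ⬝ᵥ (L *ᵥ (w + m) - s))) : ℝ) : ℂ) *
        ((k * Real.exp (-Real.pi * ((L *ᵥ w - s) ⬝ᵥ (L *ᵥ w - s))) : ℝ) : ℂ) * hE -
        cexp (I * ((ψ m + t * (s' ⬝ᵥ p) : ℝ) : ℂ)) *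
          cexp (I * (((L *ᵥ w - s') ⬝ᵥ (t • p) : ℝ) : ℂ)) * hK'
  have hI := (integral_congr_ae (ae_of_all volume hpt)).trans
    ((integral_const_mul _ _).trans (congrArg _ (integral_comp_mulVec L hL F)))
  rw [ambiguity, hI, hF,
    integral_sub_right_eq_self (fun y : Phase d =>
      ((Real.exp (-(2 * Real.pi) * (y ⬝ᵥ y)) : ℝ) : ℂ) * cexp (I * ((y ⬝ᵥ (t • p) : ℝ) : ℂ))) s',
    integral_gaussian_mul_cexp (by positivity), enorm_mul, enorm_mul, enorm_exp_I_mul_ofReal,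
    mul_one, enorm_smul, ← ofReal_norm, ← ofReal_norm, ← ofReal_norm, norm_real, norm_real,
    Real.norm_of_nonneg (by positivity), Real.norm_of_nonneg (by positivity),
    Real.norm_of_nonneg (by positivity), ← ENNReal.ofReal_mul (by positivity),
    ← ENNReal.ofReal_mul (by positivity)]
  congr 1
  have h1 : (Real.pi / (2 * Real.pi)) ^ ((Fintype.card (Fin d ⊕ Fin d) : ℝ) / 2) =
      (1 / 2 : ℝ) ^ d := by
    rw [Fintype.card_sum, Fintype.card_fin, ← Real.rpow_natCast]
    congr 1
    · field_simp
    · push_cast; ring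
  have h2 : -((t • p) ⬝ᵥ (t • p)) / (4 * (2 * Real.pi)) =
      -(t ^ 2 / (8 * Real.pi)) * (p ⬝ᵥ p) := by
    rw [dotProduct_smul, smul_dotProduct, smul_eq_mul, smul_eq_mul]
    ring
  rw [h1, h2, hK]
  ring

lemma parity_comp_adjoint :
    (parity d).toContinuousLinearMap ∘L
      ContinuousLinearMap.adjoint (parity d).toContinuousLinearMap =
      ContinuousLinearMap.id ℂ (L2 d) := by
  have h : ContinuousLinearMap.adjoint (parity d).toContinuousLinearMap =
      (parity d).toContinuousLinearMap := by
    rw [eq_comm, ContinuousLinearMap.eq_adjoint_iff]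
    exact fun u v => inner_parity_left u v
  rw [h]
  ext1 u
  exact parity_parity u

lemma weylOp_comp_adjoint (hbar : ℝ) {a b : Phase d → ℂ} (ha : Integrable a) (hb : Integrable b) :
    weylOp hbar a ha ∘L ContinuousLinearMap.adjoint (weylOp hbar b hb) =
      (((1 / (Real.pi * hbar : ℝ) ^ d) ^ 2 : ℝ) : ℂ) •
        (superpose (2 / hbar) a ha ∘L ContinuousLinearMap.adjoint (superpose (2 / hbar) b hb)) := by
  rw [weylOp, weylOp, map_smulₛₗ, ContinuousLinearMap.adjoint_comp, ContinuousLinearMap.smul_comp,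
    ContinuousLinearMap.comp_smulₛₗ, smul_smul, conj_ofReal, RingHom.id_apply, ← ofReal_mul, ← sq,
    ContinuousLinearMap.comp_assoc,
    ← ContinuousLinearMap.comp_assoc (parity d).toContinuousLinearMap, parity_comp_adjoint,
    ContinuousLinearMap.id_comp]

/-- The Gaussian integral that controls the product of the two quantizations. -/
def overlap (t : ℝ) (B N : Mat d ℝ) : ℝ≥0∞ :=
  ∫⁻ x : Phase d, ENNReal.ofReal (Real.exp (-(t ^ 2 / (8 * Real.pi)) *
      (((B⁻¹)ᵀ *ᵥ (Matrix.J (Fin d) ℝ *ᵥ x)) ⬝ᵥ ((B⁻¹)ᵀ *ᵥ (Matrix.J (Fin d) ℝ *ᵥ x))))) *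
    ∫⁻ y : Phase d, ENNReal.ofReal
      (Real.exp (-(Real.pi / 2) *
        ((B *ᵥ (y - (2 : ℝ) • (N *ᵥ x))) ⬝ᵥ (B *ᵥ (y - (2 : ℝ) • (N *ᵥ x))))) *
      Real.exp (-(t ^ 2 / (8 * Real.pi)) *
        (((B⁻¹)ᵀ *ᵥ (Matrix.J (Fin d) ℝ *ᵥ y)) ⬝ᵥ ((B⁻¹)ᵀ *ᵥ (Matrix.J (Fin d) ℝ *ᵥ y)))))

/-- A rearrangement of `PᵀJP = J`. It moves the half powers past `J`, where a change of variables
absorbs them. -/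
lemma inv_transpose_mul_J {P : Mat d ℝ} (hP : P ∈ Matrix.symplecticGroup (Fin d) ℝ) :
    (P⁻¹)ᵀ * Matrix.J (Fin d) ℝ = Matrix.J (Fin d) ℝ * P := by
  have h := SymplecticGroup.mem_iff'.1 hP
  have hu : IsUnit Pᵀ.det := by rw [Matrix.det_transpose]; exact SymplecticGroup.symplectic_det hP
  rw [Matrix.transpose_nonsing_inv]
  conv_lhs => rw [← h, Matrix.mul_assoc, Matrix.nonsing_inv_mul_cancel_left _ _ hu]

/-- The substitution is `x = Mm`, `y = P(2m + m')`, for which `Pm' = y - 2Nx`. Both maps preserve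
volume, so only `N = PM⁻¹` remains. -/
theorem enorm_sq_superpose_gaussSymbol_le (t k : ℝ) {B P M N : Mat d ℝ} (hB : B.det ≠ 0)
    (hP : P ∈ Matrix.symplecticGroup (Fin d) ℝ) (hM : M ∈ Matrix.symplecticGroup (Fin d) ℝ)
    (hN : P = N * M) (hk : k ^ 2 * |B.det|⁻¹ * (1 / 2) ^ d = 1) (s s' : Phase d)
    {φ ψ φ' ψ' : Phase d → ℝ} (hφ : ∀ w m, φ (w + m) = φ w + ψ m)
    (hφ' : ∀ w m, φ' (w + m) = φ' w + ψ' m)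
    (hf : Integrable (gaussSymbol k (B * P) s φ)) (hg : Integrable (gaussSymbol k (B * M) s' φ')) :
    ‖superpose t _ hf ∘L ContinuousLinearMap.adjoint (superpose t _ hg)‖ₑ ^ 2 ≤
      overlap t B N := by
  have hPd : P.det = 1 := SymplecticGroup.det_eq_one hP
  have hMd : M.det = 1 := SymplecticGroup.det_eq_one hM
  have hBP : (B * P).det = B.det := by rw [Matrix.det_mul, hPd, mul_one]
  have hBM : (B * M).det = B.det := by rw [Matrix.det_mul, hMd, mul_one]
  have hT : ∀ {R : Mat d ℝ}, R ∈ Matrix.symplecticGroup (Fin d) ℝ → ∀ v : Phase d,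
      ((B * R)⁻¹)ᵀ *ᵥ (Matrix.J (Fin d) ℝ *ᵥ v) =
        (B⁻¹)ᵀ *ᵥ (Matrix.J (Fin d) ℝ *ᵥ (R *ᵥ v)) := by
    intro R hR v
    rw [Matrix.mul_inv_rev, Matrix.transpose_mul, Matrix.mulVec_mulVec, Matrix.mul_assoc,
      inv_transpose_mul_J hR]
    simp only [Matrix.mulVec_mulVec]
  refine (enorm_sq_superpose_comp_adjoint_le t hf hg).trans ?_
  set Ψ : Phase d → ℝ≥0∞ := fun x => ENNReal.ofReal (Real.exp (-(t ^ 2 / (8 * Real.pi)) *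
      (((B⁻¹)ᵀ *ᵥ (Matrix.J (Fin d) ℝ *ᵥ x)) ⬝ᵥ ((B⁻¹)ᵀ *ᵥ (Matrix.J (Fin d) ℝ *ᵥ x))))) *
    ∫⁻ y : Phase d, ENNReal.ofReal
      (Real.exp (-(Real.pi / 2) *
        ((B *ᵥ (y - (2 : ℝ) • (N *ᵥ x))) ⬝ᵥ (B *ᵥ (y - (2 : ℝ) • (N *ᵥ x))))) *
      Real.exp (-(t ^ 2 / (8 * Real.pi)) *
        (((B⁻¹)ᵀ *ᵥ (Matrix.J (Fin d) ℝ *ᵥ y)) ⬝ᵥ ((B⁻¹)ᵀ *ᵥ (Matrix.J (Fin d) ℝ *ᵥ y))))) with hΨ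
  have h1 : overlap t B N = ∫⁻ m, Ψ (M *ᵥ m) := by
    rw [lintegral_comp_mulVec M (by simp [hMd]), hMd]
    simp [overlap, hΨ]
  rw [h1]
  refine lintegral_mono fun m => ?_
  simp only [hΨ]
  refine mul_le_mul' ?_ (le_of_eq ?_)
  · rw [ambiguity_gaussSymbol t k (by rwa [hBM]) s' hφ', hBM, hk, one_mul]
    refine ENNReal.ofReal_le_ofReal ?_
    rw [hT hM, Matrix.mulVec_neg, Matrix.mulVec_neg, Matrix.mulVec_neg, neg_dotProduct_neg]
    -- The factor `exp(-π|BMm|²/2)` is discarded: the other Gaussian factor already controls `x`.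
    refine mul_le_of_le_one_left (Real.exp_pos _).le ?_
    rw [Real.exp_le_one_iff, neg_mul, neg_nonpos]
    exact mul_nonneg (by positivity) (real_dotProduct_self_nonneg _)
  · symm
    have h2 := lintegral_comp_mulVec P (by simp [hPd]) fun y => ENNReal.ofReal
      (Real.exp (-(Real.pi / 2) *
        ((B *ᵥ (y - (2 : ℝ) • (N *ᵥ (M *ᵥ m)))) ⬝ᵥ (B *ᵥ (y - (2 : ℝ) • (N *ᵥ (M *ᵥ m)))))) *
      Real.exp (-(t ^ 2 / (8 * Real.pi)) *
        (((B⁻¹)ᵀ *ᵥ (Matrix.J (Fin d) ℝ *ᵥ y)) ⬝ᵥ ((B⁻¹)ᵀ *ᵥ (Matrix.J (Fin d) ℝ *ᵥ y)))))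
    rw [hPd, abs_one, inv_one, ENNReal.ofReal_one, one_mul] at h2
    rw [← h2, ← lintegral_add_left_eq_self _ ((2 : ℝ) • m)]
    refine lintegral_congr fun m' => ?_
    rw [ambiguity_gaussSymbol t k (by rwa [hBP]) s hφ, hBP, hk, one_mul, hT hP]
    have h3 : B *ᵥ (P *ᵥ ((2 : ℝ) • m + m') - (2 : ℝ) • (N *ᵥ (M *ᵥ m))) = (B * P) *ᵥ m' := by
      rw [Matrix.mulVec_mulVec, ← hN, Matrix.mulVec_add, Matrix.mulVec_smul, add_sub_cancel_left,
        Matrix.mulVec_mulVec]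
    rw [h3]

end CatMap

/-! ### Bounding the overlap integral. -/

namespace CatMap

open Filter Topology
open scoped ENNReal Matrix

variable {d : ℕ}

section QuadraticBounds

variable {ι : Type*} [Fintype ι]

lemma exists_mulVec_sq_le (E : Matrix ι ι ℝ) :
    ∃ K : ℝ, 0 < K ∧ ∀ v : ι → ℝ, (E *ᵥ v) ⬝ᵥ (E *ᵥ v) ≤ K * (v ⬝ᵥ v) := by
  refine ⟨1 + ∑ i, ∑ j, E i j ^ 2, by positivity, fun v => ?_⟩
  have h1 : (E *ᵥ v) ⬝ᵥ (E *ᵥ v) ≤ (∑ i, ∑ j, E i j ^ 2) * (v ⬝ᵥ v) := by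
    rw [dotProduct, Finset.sum_mul]
    refine Finset.sum_le_sum fun i _ => ?_
    have := Finset.sum_mul_sq_le_sq_mul_sq Finset.univ (E i) v
    simpa [Matrix.mulVec, dotProduct, sq] using this
  nlinarith [real_dotProduct_self_nonneg v]

lemma exists_le_mulVec_sq [DecidableEq ι] {E : Matrix ι ι ℝ} (hE : E.det ≠ 0) :
    ∃ c : ℝ, 0 < c ∧ ∀ v : ι → ℝ, c * (v ⬝ᵥ v) ≤ (E *ᵥ v) ⬝ᵥ (E *ᵥ v) := by
  obtain ⟨K, hK, h⟩ := exists_mulVec_sq_le E⁻¹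
  refine ⟨K⁻¹, inv_pos.2 hK, fun v => ?_⟩
  have := h (E *ᵥ v)
  rw [Matrix.mulVec_mulVec, Matrix.nonsing_inv_mul _ (Ne.isUnit hE), Matrix.one_mulVec] at this
  rwa [inv_mul_le_iff₀ hK]

end QuadraticBounds

/-- The block scalar matrix `diag (g, g)`. -/
def doubleDiag (g : Fin d → ℝ) : Mat d ℝ :=
  Matrix.fromBlocks (Matrix.diagonal g) 0 0 (Matrix.diagonal g)

lemma doubleDiag_mul_J (g : Fin d → ℝ) :
    doubleDiag g * Matrix.J (Fin d) ℝ = Matrix.J (Fin d) ℝ * doubleDiag g := by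
  rw [doubleDiag, Matrix.J, Matrix.fromBlocks_multiply, Matrix.fromBlocks_multiply]
  simp

lemma det_doubleDiag (g : Fin d → ℝ) : (doubleDiag g).det = (∏ j, g j) ^ 2 := by
  rw [doubleDiag, Matrix.det_fromBlocks_zero₂₁, Matrix.det_diagonal, sq]

lemma doubleDiag_transpose (g : Fin d → ℝ) : (doubleDiag g)ᵀ = doubleDiag g := by
  simp [doubleDiag]

lemma pos_doubleDiag_mulVec (g : Fin d → ℝ) (v : Phase d) (j : Fin d) :
    (doubleDiag g *ᵥ v) (Sum.inl j) = g j * v (Sum.inl j) := by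
  simp [doubleDiag, Matrix.mulVec_diagonal]

/-- Because `diag(g, g)` commutes with `J`, the rescaling by `Q · diag(g, g)` cancels the anisotropy
of the Fourier-side Gaussian exactly. -/
lemma inv_transpose_conj_mul {Q : Mat d ℝ} (hQ : Q ∈ Matrix.symplecticGroup (Fin d) ℝ)
    {g : Fin d → ℝ} (hg : (doubleDiag g).det ≠ 0) :
    ((Q * doubleDiag g * Q⁻¹)⁻¹)ᵀ * (Matrix.J (Fin d) ℝ * (Q * doubleDiag g)) =
      (Q⁻¹)ᵀ * Matrix.J (Fin d) ℝ := by
  have hQu := SymplecticGroup.symplectic_det hQ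
  have hgu : IsUnit (doubleDiag g).det := Ne.isUnit hg
  have h := SymplecticGroup.mem_iff'.1 hQ
  rw [Matrix.mul_inv_rev, Matrix.mul_inv_rev, Matrix.nonsing_inv_nonsing_inv _ hQu,
    Matrix.transpose_mul, Matrix.transpose_mul, Matrix.transpose_nonsing_inv (doubleDiag g),
    doubleDiag_transpose]
  calc (Q⁻¹)ᵀ * (doubleDiag g)⁻¹ * Qᵀ * (Matrix.J (Fin d) ℝ * (Q * doubleDiag g))
      = (Q⁻¹)ᵀ * ((doubleDiag g)⁻¹ * ((Qᵀ * Matrix.J (Fin d) ℝ * Q) * doubleDiag g)) := by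
        simp only [Matrix.mul_assoc]
    _ = (Q⁻¹)ᵀ * Matrix.J (Fin d) ℝ := by
        rw [h, ← doubleDiag_mul_J, Matrix.nonsing_inv_mul_cancel_left _ _ hgu]

/-- The difference of the two sides is `x² + (1-h²)y²/2 + h²((3y-4r)²/6 + r²/3)`. Thus `y` cannot
compensate `2r` without cost, and `x²` can be traded for the larger `(hr)²`. -/
lemma scalar_overlap_bound {h x y r : ℝ} (hh : h ^ 2 ≤ 1) :
    1 / 2 * y ^ 2 + (h * r) ^ 2 ≤ x ^ 2 + y ^ 2 + h ^ 2 * (y - 2 * r) ^ 2 := by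
  nlinarith [sq_nonneg x, mul_nonneg (sub_nonneg.2 hh) (sq_nonneg y),
    mul_nonneg (sq_nonneg h) (sq_nonneg (3 * y - 4 * r)), mul_nonneg (sq_nonneg h) (sq_nonneg r)]

/-- The quadratic form in the overlap integral dominates a nondegenerate one in which the
unstable directions in `I` are expanded. -/
lemma quadratic_lower_bound {hbar : ℝ} {g : Fin d → ℝ} {I : Finset (Fin d)} {N : Mat d ℝ}
    {Y : Matrix (Fin d) (Fin d) ℝ} (hgI : ∀ j ∈ I, (hbar * g j ^ 2) ^ 2 ≤ 1)
    (hNY : ∀ x : Phase d, ∀ j ∈ I, (N *ᵥ x) (Sum.inl j) = (Y *ᵥ pos x) j)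
    (hY : ∀ v : Fin d → ℝ, ∀ j ∉ I, (Y *ᵥ v) j = v j) (x y : Phase d) :
    1 / 2 * (y ⬝ᵥ y) +
      (Matrix.fromBlocks (Matrix.diagonal (fun j => if j ∈ I then hbar * g j ^ 2 else 1) * Y) 0 0
        (1 : Matrix (Fin d) (Fin d) ℝ) *ᵥ x) ⬝ᵥ
      (Matrix.fromBlocks (Matrix.diagonal (fun j => if j ∈ I then hbar * g j ^ 2 else 1) * Y) 0 0
        (1 : Matrix (Fin d) (Fin d) ℝ) *ᵥ x) ≤
    x ⬝ᵥ x + y ⬝ᵥ y + hbar ^ 2 *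
      ((doubleDiag g *ᵥ (doubleDiag g *ᵥ (y - (2 : ℝ) • (N *ᵥ x)))) ⬝ᵥ
        (doubleDiag g *ᵥ (doubleDiag g *ᵥ (y - (2 : ℝ) • (N *ᵥ x))))) := by
  set V := y - (2 : ℝ) • (N *ᵥ x) with hV
  -- Only the position coordinates in `I` are kept; momenta and the other positions are controlled
  -- by `|x|²` and `|y|²` alone.
  have hD : ∑ j, (if j ∈ I then (hbar * g j ^ 2) ^ 2 * (V (Sum.inl j)) ^ 2 else 0) ≤
      hbar ^ 2 * ((doubleDiag g *ᵥ (doubleDiag g *ᵥ V)) ⬝ᵥ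
        (doubleDiag g *ᵥ (doubleDiag g *ᵥ V))) := by
    rw [dotProduct, Fintype.sum_sum_type, mul_add, Finset.mul_sum]
    refine le_add_of_le_of_nonneg (Finset.sum_le_sum fun j _ => ?_)
      (mul_nonneg (sq_nonneg _) (Finset.sum_nonneg fun j _ => mul_self_nonneg _))
    rw [pos_doubleDiag_mulVec, pos_doubleDiag_mulVec]
    split_ifs
    · exact le_of_eq (by ring)
    · exact mul_nonneg (sq_nonneg _) (mul_self_nonneg _)
  have hx : x ⬝ᵥ x = ∑ j, x (Sum.inl j) ^ 2 + ∑ j, x (Sum.inr j) ^ 2 := by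
    simp [dotProduct, sq]
  have hy : y ⬝ᵥ y = ∑ j, y (Sum.inl j) ^ 2 + ∑ j, y (Sum.inr j) ^ 2 := by
    simp [dotProduct, sq]
  have hpos : x ∘ Sum.inl = pos x := rfl
  have hYx : ∀ K : Matrix (Fin d) (Fin d) ℝ,
      (Matrix.fromBlocks K 0 0 (1 : Matrix (Fin d) (Fin d) ℝ) *ᵥ x) ⬝ᵥ
        (Matrix.fromBlocks K 0 0 (1 : Matrix (Fin d) (Fin d) ℝ) *ᵥ x) =
      ∑ j, ((K *ᵥ pos x) j) ^ 2 + ∑ j, x (Sum.inr j) ^ 2 := by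
    intro K
    simp [dotProduct, sq, Matrix.fromBlocks_mulVec, hpos]
  rw [hYx]
  refine le_trans ?_ (add_le_add_right hD _)
  rw [hx, hy]
  have hsum : 1 / 2 * ∑ j, y (Sum.inl j) ^ 2 +
      ∑ j, (((Matrix.diagonal (fun j => if j ∈ I then hbar * g j ^ 2 else 1) * Y) *ᵥ pos x) j) ^ 2 ≤
      ∑ j, x (Sum.inl j) ^ 2 + ∑ j, y (Sum.inl j) ^ 2 +
        ∑ j, (if j ∈ I then (hbar * g j ^ 2) ^ 2 * (V (Sum.inl j)) ^ 2 else 0) := by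
    rw [Finset.mul_sum, ← Finset.sum_add_distrib, ← Finset.sum_add_distrib,
      ← Finset.sum_add_distrib]
    refine Finset.sum_le_sum fun j _ => ?_
    rw [← Matrix.mulVec_mulVec, Matrix.mulVec_diagonal]
    by_cases hj : j ∈ I
    · simp only [hj, if_true]
      have : V (Sum.inl j) = y (Sum.inl j) - 2 * (Y *ᵥ pos x) j := by
        rw [hV, Pi.sub_apply, Pi.smul_apply, hNY x j hj, smul_eq_mul]
      rw [this]
      exact scalar_overlap_bound (hgI j hj)
    · simp only [hj, if_false, hY _ j hj, pos]
      nlinarith [sq_nonneg (y (Sum.inl j))]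
  have hr : 0 ≤ ∑ j, y (Sum.inr j) ^ 2 := Finset.sum_nonneg fun j _ => sq_nonneg _
  linarith

/-- Bound of the overlap integral by the inverse of the expansion factor. -/
theorem exists_overlap_le {Q : Mat d ℝ} (hQ : Q ∈ Matrix.symplecticGroup (Fin d) ℝ) :
    ∃ C : ℝ≥0∞, C ≠ ∞ ∧ ∀ (hbar : ℝ) (g : Fin d → ℝ) (I : Finset (Fin d)) (N : Mat d ℝ)
      (Y : Matrix (Fin d) (Fin d) ℝ), 0 < hbar → (∀ j, 0 < g j) →
      (∀ j ∈ I, hbar * g j ^ 2 ≤ 1) → Commute (doubleDiag g) N →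
      (∀ x : Phase d, ∀ j ∈ I, (N *ᵥ x) (Sum.inl j) = (Y *ᵥ pos x) j) →
      (∀ v : Fin d → ℝ, ∀ j ∉ I, (Y *ᵥ v) j = v j) → Y.det ≠ 0 →
      overlap (2 / hbar) (Q * doubleDiag g * Q⁻¹) (Q * N * Q⁻¹) ≤
        C * ENNReal.ofReal (hbar ^ (4 * d) * (Q * doubleDiag g * Q⁻¹).det ^ 2 *
          ((∏ j ∈ I, hbar * g j ^ 2) * |Y.det|)⁻¹) := by
  have hQu := SymplecticGroup.symplectic_det hQ
  have hQd : Q.det = 1 := SymplecticGroup.det_eq_one hQ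
  have hE1 : ((Q⁻¹)ᵀ * Matrix.J (Fin d) ℝ).det ≠ 0 := by
    rw [Matrix.det_mul, Matrix.det_transpose, Matrix.det_nonsing_inv, hQd]
    simpa using J_det_ne_zero
  obtain ⟨c₁, hc₁, hE1'⟩ := exists_le_mulVec_sq hE1
  obtain ⟨c₂, hc₂, hQ'⟩ := exists_le_mulVec_sq hQu.ne_zero
  -- The constant depends on `Q` only: `c₁` and `c₂` measure the distortion by `(Q⁻¹)ᵀJ` and by `Q`.
  set c := min (c₁ / (2 * Real.pi)) (Real.pi / 2 * c₂) with hc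
  have hcpos : 0 < c := lt_min (by positivity) (by positivity)
  set C₁ := ∫⁻ y : Phase d, ENNReal.ofReal (Real.exp (-(c / 2) * (y ⬝ᵥ y))) with hC₁
  set C₂ := ∫⁻ y : Phase d, ENNReal.ofReal (Real.exp (-c * (y ⬝ᵥ y))) with hC₂
  refine ⟨C₁ * C₂, ENNReal.mul_ne_top (lintegral_gaussian_lt_top (half_pos hcpos)).ne
    (lintegral_gaussian_lt_top hcpos).ne, ?_⟩
  intro hbar g I N Y hh hg hgI hcomm hNY hY hYdet
  set D := doubleDiag g with hD
  set B := Q * D * Q⁻¹ with hB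
  have hDdet : D.det ≠ 0 := by
    rw [hD, det_doubleDiag]
    exact pow_ne_zero _ (Finset.prod_pos fun j _ => hg j).ne'
  have hBdet : B.det = D.det := by
    rw [hB, Matrix.det_mul, Matrix.det_mul, Matrix.det_nonsing_inv, hQd]
    simp
  -- In these coordinates the two `J`-terms become independent of `ħ` and `D`, and `B` becomes `ħ Q
  -- D²`. Applied to both `x` and `y`, the change costs `|det L|²`, the source of `ħ^{4d} (det B)²`.
  set L : Mat d ℝ := hbar • (Q * D) with hL
  have hLabs : |L.det| = hbar ^ (2 * d) * |B.det| := by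
    rw [hL, Matrix.det_smul, Matrix.det_mul, hQd, one_mul, hBdet, abs_mul,
      abs_of_pos (pow_pos hh _), Fintype.card_sum, Fintype.card_fin, two_mul]
  have hLdet : L.det ≠ 0 := by
    rw [← abs_ne_zero, hLabs, hBdet]
    exact mul_ne_zero (pow_pos hh _).ne' (abs_ne_zero.2 hDdet)
  set Z : Mat d ℝ := Matrix.fromBlocks
    (Matrix.diagonal (fun j => if j ∈ I then hbar * g j ^ 2 else 1) * Y) 0 0 1 with hZ
  have hprod : 0 < ∏ j ∈ I, hbar * g j ^ 2 :=
    Finset.prod_pos fun j _ => mul_pos hh (pow_pos (hg j) 2)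
  have hZabs : |Z.det| = (∏ j ∈ I, hbar * g j ^ 2) * |Y.det| := by
    rw [hZ, Matrix.det_fromBlocks_zero₂₁, Matrix.det_one, mul_one, Matrix.det_mul,
      Matrix.det_diagonal, Finset.prod_ite_mem, Finset.univ_inter, abs_mul, abs_of_pos hprod]
  have hZdet : Z.det ≠ 0 := by
    rw [← abs_ne_zero, hZabs]
    exact mul_ne_zero hprod.ne' (abs_ne_zero.2 hYdet)
  have hκ : (2 / hbar) ^ 2 / (8 * Real.pi) * hbar ^ 2 = 1 / (2 * Real.pi) := by
    field_simp; norm_num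
  have hJL : ∀ x : Phase d, c * (x ⬝ᵥ x) ≤ (2 / hbar) ^ 2 / (8 * Real.pi) *
      (((B⁻¹)ᵀ *ᵥ (Matrix.J (Fin d) ℝ *ᵥ (L *ᵥ x))) ⬝ᵥ
        ((B⁻¹)ᵀ *ᵥ (Matrix.J (Fin d) ℝ *ᵥ (L *ᵥ x)))) := by
    intro x
    have h1 : (B⁻¹)ᵀ *ᵥ (Matrix.J (Fin d) ℝ *ᵥ (L *ᵥ x)) =
        hbar • (((Q⁻¹)ᵀ * Matrix.J (Fin d) ℝ) *ᵥ x) := by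
      rw [← inv_transpose_conj_mul hQ hDdet, hL, Matrix.smul_mulVec, Matrix.mulVec_smul,
        Matrix.mulVec_smul, Matrix.mulVec_mulVec, Matrix.mulVec_mulVec, Matrix.mul_assoc]
    rw [h1, dotProduct_smul, smul_dotProduct, smul_eq_mul, smul_eq_mul]
    calc c * (x ⬝ᵥ x) ≤ c₁ / (2 * Real.pi) * (x ⬝ᵥ x) :=
          mul_le_mul_of_nonneg_right (min_le_left _ _) (real_dotProduct_self_nonneg x)
      _ = 1 / (2 * Real.pi) * (c₁ * (x ⬝ᵥ x)) := by ring
      _ ≤ 1 / (2 * Real.pi) * _ := mul_le_mul_of_nonneg_left (hE1' x) (by positivity)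
      _ = _ := by rw [← hκ]; ring
  have hBL : ∀ x y : Phase d, c * (hbar ^ 2 *
      ((D *ᵥ (D *ᵥ (y - (2 : ℝ) • (N *ᵥ x)))) ⬝ᵥ (D *ᵥ (D *ᵥ (y - (2 : ℝ) • (N *ᵥ x)))))) ≤
      Real.pi / 2 * ((B *ᵥ (L *ᵥ y - (2 : ℝ) • ((Q * N * Q⁻¹) *ᵥ (L *ᵥ x)))) ⬝ᵥ
        (B *ᵥ (L *ᵥ y - (2 : ℝ) • ((Q * N * Q⁻¹) *ᵥ (L *ᵥ x))))) := by
    intro x y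
    have h2 : (Q * N * Q⁻¹) * L = L * N := by
      rw [hL, Matrix.mul_smul, Matrix.smul_mul, ← Matrix.mul_assoc,
        Matrix.nonsing_inv_mul_cancel_right _ _ hQu, Matrix.mul_assoc, ← hcomm.eq,
        Matrix.mul_assoc]
    have h3 : B * L = hbar • (Q * D * D) := by
      rw [hL, hB, Matrix.mul_smul, ← Matrix.mul_assoc,
        Matrix.nonsing_inv_mul_cancel_right _ _ hQu]
    have h1 : B *ᵥ (L *ᵥ y - (2 : ℝ) • ((Q * N * Q⁻¹) *ᵥ (L *ᵥ x))) =
        hbar • (Q *ᵥ (D *ᵥ (D *ᵥ (y - (2 : ℝ) • (N *ᵥ x))))) := by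
      have h4 : L *ᵥ y - (2 : ℝ) • ((Q * N * Q⁻¹) *ᵥ (L *ᵥ x)) =
          L *ᵥ (y - (2 : ℝ) • (N *ᵥ x)) := by
        rw [Matrix.mulVec_mulVec, h2, ← Matrix.mulVec_mulVec, Matrix.mulVec_sub, Matrix.mulVec_smul]
      rw [h4, Matrix.mulVec_mulVec, h3, Matrix.smul_mulVec, Matrix.mulVec_mulVec,
        Matrix.mulVec_mulVec]
    rw [h1]
    generalize D *ᵥ (D *ᵥ (y - (2 : ℝ) • (N *ᵥ x))) = V
    rw [dotProduct_smul, smul_dotProduct, smul_eq_mul, smul_eq_mul]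
    calc c * (hbar ^ 2 * (V ⬝ᵥ V)) ≤ (Real.pi / 2 * c₂) * (hbar ^ 2 * (V ⬝ᵥ V)) :=
          mul_le_mul_of_nonneg_right (min_le_right _ _)
            (mul_nonneg (sq_nonneg _) (real_dotProduct_self_nonneg V))
      _ = Real.pi / 2 * hbar ^ 2 * (c₂ * (V ⬝ᵥ V)) := by ring
      _ ≤ Real.pi / 2 * hbar ^ 2 * _ := mul_le_mul_of_nonneg_left (hQ' V) (by positivity)
      _ = _ := by ring
  have hgI2 : ∀ j ∈ I, (hbar * g j ^ 2) ^ 2 ≤ 1 := fun j hj =>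
    pow_le_one₀ (mul_nonneg hh.le (sq_nonneg _)) (hgI j hj)
  rw [overlap, lintegral_eq_mul_comp_mulVec L hLdet]
  have hpt : ∀ x : Phase d, ENNReal.ofReal (Real.exp (-((2 / hbar) ^ 2 / (8 * Real.pi)) *
      (((B⁻¹)ᵀ *ᵥ (Matrix.J (Fin d) ℝ *ᵥ (L *ᵥ x))) ⬝ᵥ
        ((B⁻¹)ᵀ *ᵥ (Matrix.J (Fin d) ℝ *ᵥ (L *ᵥ x)))))) *
    ∫⁻ y : Phase d, ENNReal.ofReal
      (Real.exp (-(Real.pi / 2) *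
        ((B *ᵥ (y - (2 : ℝ) • ((Q * N * Q⁻¹) *ᵥ (L *ᵥ x)))) ⬝ᵥ
          (B *ᵥ (y - (2 : ℝ) • ((Q * N * Q⁻¹) *ᵥ (L *ᵥ x)))))) *
      Real.exp (-((2 / hbar) ^ 2 / (8 * Real.pi)) *
        (((B⁻¹)ᵀ *ᵥ (Matrix.J (Fin d) ℝ *ᵥ y)) ⬝ᵥ ((B⁻¹)ᵀ *ᵥ (Matrix.J (Fin d) ℝ *ᵥ y))))) ≤
      ENNReal.ofReal |L.det| * C₁ *
        ENNReal.ofReal (Real.exp (-c * ((Z *ᵥ x) ⬝ᵥ (Z *ᵥ x)))) := by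
    intro x
    rw [lintegral_eq_mul_comp_mulVec L hLdet, mul_left_comm, mul_assoc (ENNReal.ofReal |L.det|),
      hC₁]
    refine mul_le_mul_right ?_ _
    rw [← lintegral_const_mul' _ _ ENNReal.ofReal_ne_top,
      ← lintegral_mul_const' _ _ ENNReal.ofReal_ne_top]
    refine lintegral_mono fun y => ?_
    rw [← ENNReal.ofReal_mul (Real.exp_pos _).le, ← ENNReal.ofReal_mul (Real.exp_pos _).le,
      ← Real.exp_add, ← Real.exp_add, ← Real.exp_add]
    refine ENNReal.ofReal_le_ofReal (Real.exp_le_exp.2 ?_)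
    have h1 := mul_le_mul_of_nonneg_left
      (quadratic_lower_bound hgI2 hNY hY x y) hcpos.le
    have h2 := hJL x
    have h3 := hJL y
    have h4 := hBL x y
    rw [← hZ] at h1
    simp only [neg_mul] at *
    linarith
  refine (mul_le_mul_right (lintegral_mono hpt) _).trans (le_of_eq ?_)
  rw [lintegral_const_mul' _ _ (ENNReal.mul_ne_top ENNReal.ofReal_ne_top
    (lintegral_gaussian_lt_top (half_pos hcpos)).ne),
    lintegral_comp_mulVec Z hZdet fun x => ENNReal.ofReal (Real.exp (-c * (x ⬝ᵥ x))), ← hC₂]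
  have h5 : hbar ^ (4 * d) * B.det ^ 2 * ((∏ j ∈ I, hbar * g j ^ 2) * |Y.det|)⁻¹ =
      |L.det| * |L.det| * |Z.det|⁻¹ := by
    rw [hLabs, hZabs, ← sq_abs B.det]
    ring
  rw [h5, ENNReal.ofReal_mul (by positivity), ENNReal.ofReal_mul (by positivity)]
  ring

end CatMap

/-! ### Block structure of the reduction and expansion of the fast blocks. -/

namespace CatMap

open Filter Topology
open scoped ENNReal Matrix

section BlockDiagonal

variable {m : ℕ} {R : Type*} [CommRing R] {n : Fin m → Type*} [∀ i, Fintype (n i)]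
  [∀ i, DecidableEq (n i)]

lemma det_blockDiagonal' (M : ∀ i, Matrix (n i) (n i) R) :
    (Matrix.blockDiagonal' M).det = ∏ i, (M i).det := by
  rw [(Matrix.blockTriangular_blockDiagonal' M).det_fintype]
  refine Finset.prod_congr rfl fun i _ => ?_
  rw [← Matrix.det_submatrix_equiv_self (Equiv.sigmaSubtype (β := n) i).symm]
  congr 1
  ext a b
  exact Matrix.blockDiagonal'_apply_eq M i a b

lemma charmatrix_blockDiagonal' (M : ∀ i, Matrix (n i) (n i) R) :
    (Matrix.blockDiagonal' M).charmatrix = Matrix.blockDiagonal' fun i => (M i).charmatrix := by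
  ext ⟨i, a⟩ ⟨j, b⟩ : 1
  by_cases hij : i = j
  · subst hij
    by_cases hab : a = b
    · subst hab
      simp [Matrix.charmatrix_apply_eq]
    · have : (⟨i, a⟩ : Σ i, n i) ≠ ⟨i, b⟩ := by simpa using hab
      rw [Matrix.charmatrix_apply_ne _ _ _ this, Matrix.blockDiagonal'_apply_eq,
        Matrix.blockDiagonal'_apply_eq, Matrix.charmatrix_apply_ne _ _ _ hab]
  · have : (⟨i, a⟩ : Σ i, n i) ≠ ⟨j, b⟩ := fun h => hij (congrArg Sigma.fst h)
    rw [Matrix.charmatrix_apply_ne _ _ _ this, Matrix.blockDiagonal'_apply_ne _ _ _ hij,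
      Matrix.blockDiagonal'_apply_ne _ _ _ hij]
    simp

lemma charpoly_blockDiagonal' (M : ∀ i, Matrix (n i) (n i) R) :
    (Matrix.blockDiagonal' M).charpoly = ∏ i, (M i).charpoly := by
  rw [Matrix.charpoly, charmatrix_blockDiagonal', det_blockDiagonal']
  rfl

end BlockDiagonal

/-- Grouping coordinates by block instead of by position and momentum makes the diamond product
block diagonal, so its characteristic polynomial factors. -/
lemma diamond_eq_reindex {m : ℕ} {k : Fin m → ℕ}
    (M : ∀ i, Matrix (Fin (k i) ⊕ Fin (k i)) (Fin (k i) ⊕ Fin (k i)) ℝ) :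
    diamond M = Matrix.reindex (Equiv.sigmaSumDistrib _ _) (Equiv.sigmaSumDistrib _ _)
      (Matrix.blockDiagonal' M) := by
  ext a b
  rcases a with ⟨i, a⟩ | ⟨i, a⟩ <;> rcases b with ⟨j, b⟩ | ⟨j, b⟩ <;>
  · by_cases hij : i = j
    · subst hij
      simp [diamond, Equiv.sigmaSumDistrib, Sigma.map, Matrix.toBlocks₁₁, Matrix.toBlocks₁₂,
        Matrix.toBlocks₂₁, Matrix.toBlocks₂₂]
    · simp [diamond, Equiv.sigmaSumDistrib, Sigma.map, Matrix.blockDiagonal'_apply_ne _ _ _ hij]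

section Spectrum

variable {ι : Type} [Fintype ι] [DecidableEq ι]

lemma mem_complexSpectrum_iff (X : Matrix ι ι ℝ) (z : ℂ) :
    z ∈ complexSpectrum X ↔ (X.charpoly.map (algebraMap ℝ ℂ)).IsRoot z := by
  rw [complexSpectrum, Matrix.mem_spectrum_iff_isRoot_charpoly, ← Matrix.charpoly_map]
  rfl

lemma complexSpectrum_finite (X : Matrix ι ι ℝ) : (complexSpectrum X).Finite :=
  Matrix.finite_spectrum _

lemma complexSpectrum_nonempty [Nonempty ι] (X : Matrix ι ι ℝ) : (complexSpectrum X).Nonempty :=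
  spectrum.nonempty_of_isAlgClosed_of_finiteDimensional ℂ _

lemma abs_det_eq_of_complexSpectrum {X : Matrix ι ι ℝ} {c : ℝ}
    (h : ∀ z ∈ complexSpectrum X, ‖z‖ = c) : |X.det| = c ^ Fintype.card ι := by
  set Xc : Matrix ι ι ℂ := X.map (algebraMap ℝ ℂ) with hXc
  have h1 : Xc.det = (X.det : ℂ) := by
    rw [hXc, ← RingHom.mapMatrix_apply, ← RingHom.map_det]
    rfl
  have h2 : ∀ z ∈ Xc.charpoly.roots, ‖z‖ = c := by
    intro z hz
    refine h z ?_
    rw [complexSpectrum, Matrix.mem_spectrum_iff_isRoot_charpoly]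
    exact Polynomial.isRoot_of_mem_roots hz
  have h3 : Multiset.card Xc.charpoly.roots = Fintype.card ι := by
    rw [Polynomial.splits_iff_card_roots.1 (IsAlgClosed.splits _),
      Matrix.charpoly_natDegree_eq_dim]
  have h4 : ‖Xc.charpoly.roots.prod‖ = (Xc.charpoly.roots.map fun z => ‖z‖).prod :=
    map_multiset_prod (normHom : ℂ →*₀ ℝ) _
  rw [← Real.norm_eq_abs, ← Complex.norm_real, ← h1, Matrix.det_eq_prod_roots_charpoly, h4,
    Multiset.map_congr rfl h2, Multiset.map_const', Multiset.prod_replicate, h3]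

end Spectrum

namespace OseledetsReduction

variable {d : ℕ} {A : Mat d ℝ} (S : OseledetsReduction A)

/-- The identification of the block coordinates with the coordinates of `ℝ^d`. -/
def coordEquiv : (Σ i, Fin (S.dim i)) ≃ Fin d := finSigmaFinEquiv.trans (finCongr S.sum_dim)

/-- The diagonal blocks `A_0, …, A_r`. -/
def block : ∀ i : Fin (S.r + 1), Mat (S.dim i) ℝ :=
  Fin.cases S.A0 fun i => Matrix.fromBlocks (S.D i) 0 0 ((S.D i).transpose)⁻¹

/-- The matrix `A_0 ⋄ ⋯ ⋄ A_r` on phase space. -/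
def core : Mat d ℝ :=
  Matrix.reindex (Equiv.sumCongr S.coordEquiv S.coordEquiv)
    (Equiv.sumCongr S.coordEquiv S.coordEquiv) (diamond (k := S.dim) S.block)

lemma eq_core : A = S.Q * S.core * S.Q⁻¹ := S.eq_conj

lemma det_Q : S.Q.det = 1 := SymplecticGroup.det_eq_one S.Q_mem

lemma blockOf_coordEquiv (σ : Σ i, Fin (S.dim i)) : S.blockOf (S.coordEquiv σ) = σ.1 := by
  change (S.coordEquiv.symm (S.coordEquiv σ)).1 = σ.1
  rw [Equiv.symm_apply_apply]

lemma charpoly_eq_prod : A.charpoly = ∏ i, (S.block i).charpoly := by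
  have hQ : IsUnit S.Q := (Matrix.isUnit_iff_isUnit_det _).2 (by rw [det_Q]; exact isUnit_one)
  have h : (S.Q * S.core * S.Q⁻¹).charpoly = S.core.charpoly := by
    rw [Matrix.charpoly_mul_comm, ← Matrix.mul_assoc, Matrix.nonsing_inv_mul _
      ((Matrix.isUnit_iff_isUnit_det _).1 hQ), Matrix.one_mul]
  conv_lhs => rw [S.eq_core]
  rw [h, core, Matrix.charpoly_reindex, diamond_eq_reindex, Matrix.charpoly_reindex,
    charpoly_blockDiagonal']

lemma complexSpectrum_D_subset (i : Fin S.r) : complexSpectrum (S.D i) ⊆ complexSpectrum A := by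
  intro z hz
  rw [mem_complexSpectrum_iff] at hz ⊢
  have h1 : (S.D i).charpoly ∣ A.charpoly := by
    rw [S.charpoly_eq_prod]
    refine Dvd.dvd.trans ?_ (Finset.dvd_prod_of_mem _ (Finset.mem_univ i.succ))
    rw [block, Fin.cases_succ, Matrix.charpoly_fromBlocks_zero₁₂]
    exact dvd_mul_right _ _
  exact hz.dvd (Polynomial.map_dvd _ h1)

/-- A block `D_i` has positive size, hence an eigenvalue; it is also an eigenvalue of `A`, because
the characteristic polynomial of `D_i` divides that of `A`. -/
lemma lam_le_lamMax (i : Fin (S.r + 1)) (hi : i ≠ 0) : S.lam i ≤ lamMax A := by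
  obtain ⟨j, rfl⟩ := Fin.exists_succ_eq.2 hi
  have : Nonempty (Fin (S.dim j.succ)) := ⟨⟨0, S.dim_pos _ hi⟩⟩
  obtain ⟨z, hz⟩ := complexSpectrum_nonempty (S.D j)
  have h1 : Real.log ‖z‖ ≤ lamMax A :=
    le_csSup ((complexSpectrum_finite A).image _).bddAbove
      ⟨z, S.complexSpectrum_D_subset j hz, rfl⟩
  rwa [S.D_spec j z hz, Real.log_exp] at h1

/-- The labels of the blocks with `2 λ_i > λ_max`. -/
def fastBlocks : Finset (Fin (S.r + 1)) := {i | 0 < 2 * S.lam i - lamMax A}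

/-- The coordinates in the blocks with `2 λ_i > λ_max`. -/
def fastCoords : Finset (Fin d) := {j | S.blockOf j ∈ S.fastBlocks}

/-- The position parts of the blocks in `fastBlocks`, completed by the identity. -/
def expansion : Matrix (Fin d) (Fin d) ℝ :=
  Matrix.reindex S.coordEquiv S.coordEquiv (Matrix.blockDiagonal' fun i =>
    if i ∈ S.fastBlocks then (S.block i).toBlocks₁₁ else 1)

lemma ne_zero_of_mem_fastBlocks (hmax : 0 < lamMax A) {i : Fin (S.r + 1)}
    (hi : i ∈ S.fastBlocks) : i ≠ 0 := by
  rintro rfl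
  have := (Finset.mem_filter.1 hi).2
  rw [S.lam_zero] at this
  linarith

lemma core_inl_inl {j : Fin d} (hj : j ∈ S.fastCoords) (b : Fin d) :
    S.core (Sum.inl j) (Sum.inl b) = S.expansion j b := by
  have hj' : (S.coordEquiv.symm j).1 ∈ S.fastBlocks := (Finset.mem_filter.1 hj).2
  simp only [core, expansion, Matrix.reindex_apply, Matrix.submatrix_apply, diamond,
    Equiv.sumCongr_symm, Equiv.sumCongr_apply, Sum.map_inl, Matrix.fromBlocks_apply₁₁,
    Matrix.blockDiagonal'_apply, hj', if_true]

lemma core_inl_inr (hmax : 0 < lamMax A) {j : Fin d} (hj : j ∈ S.fastCoords) (b : Fin d) :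
    S.core (Sum.inl j) (Sum.inr b) = 0 := by
  have hj' : (S.coordEquiv.symm j).1 ∈ S.fastBlocks := (Finset.mem_filter.1 hj).2
  have h0 : (S.block (S.coordEquiv.symm j).1).toBlocks₁₂ = 0 := by
    obtain ⟨i, hi⟩ := Fin.exists_succ_eq.2 (S.ne_zero_of_mem_fastBlocks hmax hj')
    rw [← hi, block, Fin.cases_succ, Matrix.toBlocks_fromBlocks₁₂]
  simp only [core, Matrix.reindex_apply, Matrix.submatrix_apply, diamond,
    Equiv.sumCongr_symm, Equiv.sumCongr_apply, Sum.map_inl, Sum.map_inr,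
    Matrix.fromBlocks_apply₁₂, Matrix.blockDiagonal'_apply, h0]
  simp

lemma expansion_apply_eq_zero {j b : Fin d} (h : S.blockOf j ≠ S.blockOf b) :
    S.expansion j b = 0 := by
  simp only [expansion, Matrix.reindex_apply, Matrix.submatrix_apply, Matrix.blockDiagonal'_apply]
  exact dif_neg h

lemma expansion_mulVec_of_notMem {j : Fin d} (hj : j ∉ S.fastCoords) (v : Fin d → ℝ) :
    (S.expansion *ᵥ v) j = v j := by
  have hj' : (S.coordEquiv.symm j).1 ∉ S.fastBlocks := fun h =>
    hj (Finset.mem_filter.2 ⟨Finset.mem_univ _, h⟩)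
  have h1 : ∀ b, S.expansion j b = (1 : Matrix (Fin d) (Fin d) ℝ) j b := by
    intro b
    have h2 : (1 : Matrix (Fin d) (Fin d) ℝ) = Matrix.reindex S.coordEquiv S.coordEquiv
        (Matrix.blockDiagonal' fun _ => 1) := by
      change _ = Matrix.reindex S.coordEquiv S.coordEquiv (Matrix.blockDiagonal' 1)
      rw [Matrix.blockDiagonal'_one]
      simp
    rw [h2]
    simp only [expansion, Matrix.reindex_apply, Matrix.submatrix_apply,
      Matrix.blockDiagonal'_apply, hj', if_false]
  simp only [Matrix.mulVec, dotProduct, h1]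
  simp [Matrix.one_apply]

lemma core_mulVec_inl (hmax : 0 < lamMax A) {j : Fin d} (hj : j ∈ S.fastCoords) (x : Phase d) :
    (S.core *ᵥ x) (Sum.inl j) = (S.expansion *ᵥ pos x) j := by
  simp only [Matrix.mulVec, dotProduct, Fintype.sum_sum_type, S.core_inl_inl hj,
    S.core_inl_inr hmax hj, zero_mul, Finset.sum_const_zero, add_zero, pos]

lemma expansion_mulVec_congr {j : Fin d} (hj : j ∈ S.fastCoords) {v w : Fin d → ℝ}
    (h : ∀ b ∈ S.fastCoords, v b = w b) : (S.expansion *ᵥ v) j = (S.expansion *ᵥ w) j := by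
  simp only [Matrix.mulVec, dotProduct]
  refine Finset.sum_congr rfl fun b _ => ?_
  by_cases hb : S.blockOf j = S.blockOf b
  · rw [h b]
    have := (Finset.mem_filter.1 hj).2
    rw [hb] at this
    exact Finset.mem_filter.2 ⟨Finset.mem_univ _, this⟩
  · rw [S.expansion_apply_eq_zero hb, zero_mul, zero_mul]

/-- A fast block is never the neutral one, so its position-momentum block vanishes, and fast
positions evolve among themselves under iteration. -/
lemma core_pow_mulVec_inl (hmax : 0 < lamMax A) (n : ℕ) (x : Phase d) :
    ∀ j ∈ S.fastCoords, (S.core ^ n *ᵥ x) (Sum.inl j) = (S.expansion ^ n *ᵥ pos x) j := by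
  induction n with
  | zero => intro j _; simp [pos]
  | succ n ih =>
    intro j hj
    rw [pow_succ', pow_succ', ← Matrix.mulVec_mulVec, ← Matrix.mulVec_mulVec,
      S.core_mulVec_inl hmax hj]
    exact S.expansion_mulVec_congr hj ih

lemma expansion_pow_mulVec_of_notMem (n : ℕ) (v : Fin d → ℝ) :
    ∀ j ∉ S.fastCoords, (S.expansion ^ n *ᵥ v) j = v j := by
  induction n with
  | zero => intro j _; simp
  | succ n ih =>
    intro j hj
    rw [pow_succ', ← Matrix.mulVec_mulVec, S.expansion_mulVec_of_notMem hj, ih j hj]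

/-- Only the determinant of the expansion matters for the integral, so the moduli of the eigenvalues
suffice and Jordan blocks cause no loss. -/
lemma abs_det_expansion (hmax : 0 < lamMax A) :
    |S.expansion.det| = Real.exp (∑ i ∈ S.fastBlocks, (S.dim i : ℝ) * S.lam i) := by
  rw [expansion, Matrix.det_reindex_self, det_blockDiagonal', Finset.abs_prod, Real.exp_sum,
    ← Fintype.prod_ite_mem S.fastBlocks]
  refine Finset.prod_congr rfl fun i _ => ?_
  split_ifs with hi
  · obtain ⟨j, rfl⟩ := Fin.exists_succ_eq.2 (S.ne_zero_of_mem_fastBlocks hmax hi)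
    rw [block, Fin.cases_succ, Matrix.toBlocks_fromBlocks₁₁,
      abs_det_eq_of_complexSpectrum (S.D_spec j), Fintype.card_fin, ← Real.exp_nat_mul]
  · simp

lemma prod_fastCoords (c : Fin (S.r + 1) → ℝ) :
    ∏ j ∈ S.fastCoords, c (S.blockOf j) = ∏ i ∈ S.fastBlocks, c i ^ S.dim i := by
  rw [fastCoords, Finset.prod_filter, ← S.coordEquiv.prod_comp]
  simp only [blockOf_coordEquiv]
  rw [Fintype.prod_sigma, ← Fintype.prod_ite_mem S.fastBlocks]
  refine Finset.prod_congr rfl fun i _ => ?_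
  split_ifs <;> simp

lemma core_apply_eq_zero {a b : Fin d ⊕ Fin d}
    (h : Sum.elim S.blockOf S.blockOf a ≠ Sum.elim S.blockOf S.blockOf b) : S.core a b = 0 := by
  simp only [core, Matrix.reindex_apply, Matrix.submatrix_apply, diamond, Equiv.sumCongr_symm]
  rcases a with a | a <;> rcases b with b | b <;>
  · simp only [Equiv.sumCongr_apply, Sum.map_inl, Sum.map_inr, Matrix.fromBlocks_apply₁₁,
      Matrix.fromBlocks_apply₁₂, Matrix.fromBlocks_apply₂₁, Matrix.fromBlocks_apply₂₂,
      Matrix.blockDiagonal'_apply]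
    exact dif_neg h

/-- A diagonal matrix that is scalar on each block commutes with every matrix respecting the blocks.
-/
lemma commute_doubleDiag_core (c : Fin (S.r + 1) → ℝ) :
    Commute (doubleDiag fun j => c (S.blockOf j)) S.core := by
  have h : doubleDiag (fun j => c (S.blockOf j)) =
      Matrix.diagonal fun a => c (Sum.elim S.blockOf S.blockOf a) := by
    rw [doubleDiag, Matrix.fromBlocks_diagonal]
    congr 1
    funext a
    cases a <;> rfl
  rw [h]
  ext a b
  rw [Matrix.diagonal_mul, Matrix.mul_diagonal]
  by_cases hab : Sum.elim S.blockOf S.blockOf a = Sum.elim S.blockOf S.blockOf b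
  · rw [hab, mul_comm]
  · rw [S.core_apply_eq_zero hab]; simp

lemma pow_eq_core_pow (n : ℕ) : A ^ n = S.Q * S.core ^ n * S.Q⁻¹ := by
  have hQ : IsUnit S.Q.det := by rw [det_Q]; exact isUnit_one
  induction n with
  | zero => simp [Matrix.mul_nonsing_inv _ hQ]
  | succ n ih =>
    rw [pow_succ, ih, pow_succ]
    refine (congrArg (fun X => S.Q * S.core ^ n * S.Q⁻¹ * X) S.eq_core).trans ?_
    simp only [← Matrix.mul_assoc]
    rw [Matrix.nonsing_inv_mul_cancel_right _ _ hQ]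

lemma B_eq (ε₀ hbar : ℝ) : S.B ε₀ hbar =
    S.Q * doubleDiag (fun j => hbar ^ (-S.gam ε₀ (S.blockOf j))) * S.Q⁻¹ := rfl

end OseledetsReduction

end CatMap

/-! ### Half powers, normalization, and exponents at the time `n_E(ħ)`. -/

namespace CatMap

open Filter Topology
open scoped ENNReal Matrix

variable {d : ℕ} {A : Mat d ℝ}

lemma inv_mem_symplecticGroup {X : Mat d ℝ} (hX : X ∈ Matrix.symplecticGroup (Fin d) ℝ) :
    X⁻¹ ∈ Matrix.symplecticGroup (Fin d) ℝ := by
  have h := ((⟨X, hX⟩ : Matrix.symplecticGroup (Fin d) ℝ)⁻¹).2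
  rwa [SymplecticGroup.coe_inv'] at h

lemma pow_add_mul_inv_pow {X : Mat d ℝ} (hX : IsUnit X.det) (a b : ℕ) :
    X ^ (a + b) * X⁻¹ ^ b = X ^ a := by
  rw [pow_add, Matrix.mul_assoc, Matrix.inv_pow',
    Matrix.mul_nonsing_inv _ (by rw [Matrix.det_pow]; exact hX.pow b), Matrix.mul_one]

/-- All that is needed of a half power, and what the three readings share, is symplecticity and `P n
= Aⁿ M n`. -/
lemma IsHalfPower.symplectic {P M : ℕ → Mat d ℝ} (h : IsHalfPower A P M)
    (hA : A ∈ Matrix.symplecticGroup (Fin d) ℝ) (n : ℕ) :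
    P n ∈ Matrix.symplecticGroup (Fin d) ℝ ∧ M n ∈ Matrix.symplecticGroup (Fin d) ℝ ∧
      P n = A ^ n * M n := by
  have hAu := SymplecticGroup.symplectic_det hA
  rcases h with h | h | ⟨R, hR, hRA, h⟩
  · rw [(h n).1, (h n).2]
    refine ⟨pow_mem hA _, pow_mem (inv_mem_symplecticGroup hA) _, ?_⟩
    rw [← pow_add_mul_inv_pow hAu (n / 2) (n - n / 2), Nat.add_sub_cancel' (Nat.div_le_self n 2)]
  · rw [(h n).1, (h n).2]
    refine ⟨pow_mem hA _, pow_mem (inv_mem_symplecticGroup hA) _, ?_⟩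
    rw [← pow_add_mul_inv_pow hAu (n - n / 2) (n / 2), Nat.sub_add_cancel (Nat.div_le_self n 2)]
  · rw [(h n).1, (h n).2]
    refine ⟨pow_mem hR _, pow_mem (inv_mem_symplecticGroup hR) _, ?_⟩
    rw [← hRA, ← sq, ← pow_mul, two_mul,
      pow_add_mul_inv_pow (SymplecticGroup.symplectic_det hR)]

namespace OseledetsReduction

variable (S : OseledetsReduction A)

/-- The normalization constant of the adapted Gaussian. -/
def gaussConst (ε₀ hbar : ℝ) : ℝ := (2 : ℝ) ^ ((d : ℝ) / 2) * |(S.B ε₀ hbar).det| ^ (1 / 2 : ℝ)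

lemma symbol_eq_gaussSymbol (ε₀ hbar : ℝ) (P : Mat d ℝ) (ρ ρ₀ : Phase d) :
    S.symbol ε₀ hbar P ρ ρ₀ = gaussSymbol (S.gaussConst ε₀ hbar) (S.B ε₀ hbar * P)
      (S.B ε₀ hbar *ᵥ ((Real.pi * hbar) • (Matrix.J (Fin d) ℝ).mulVec ρ + ρ₀))
      (fun w => 2 * Real.pi * ((P *ᵥ w - ρ₀) ⬝ᵥ ρ)) := by
  funext w
  rw [symbol, gaussSymbol, gauss, gaussConst, sub_sub, Matrix.mulVec_sub, Matrix.mulVec_mulVec]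
  congr 2
  push_cast
  ring

lemma det_B_pos {hbar : ℝ} (hh : 0 < hbar) (ε₀ : ℝ) : 0 < (S.B ε₀ hbar).det := by
  rw [B_eq, Matrix.det_mul, Matrix.det_mul, Matrix.det_nonsing_inv, S.det_Q, det_doubleDiag]
  simp only [one_mul, Ring.inverse_one, mul_one]
  exact pow_pos (Finset.prod_pos fun j _ => Real.rpow_pos_of_pos hh _) 2

lemma gaussConst_sq_mul {hbar : ℝ} (hh : 0 < hbar) (ε₀ : ℝ) :
    S.gaussConst ε₀ hbar ^ 2 * |(S.B ε₀ hbar).det|⁻¹ * (1 / 2) ^ d = 1 := by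
  have hB : 0 < |(S.B ε₀ hbar).det| := abs_pos.2 (S.det_B_pos hh ε₀).ne'
  have h1 : ((2 : ℝ) ^ ((d : ℝ) / 2)) ^ 2 = 2 ^ d := by
    rw [← Real.rpow_natCast, ← Real.rpow_mul (by norm_num), ← Real.rpow_natCast]
    congr 1
    push_cast
    ring
  have h2 : (|(S.B ε₀ hbar).det| ^ (1 / 2 : ℝ)) ^ 2 = |(S.B ε₀ hbar).det| := by
    rw [← Real.rpow_natCast, ← Real.rpow_mul hB.le]
    norm_num
  rw [gaussConst, mul_pow, h1, h2, mul_assoc ((2 : ℝ) ^ d), mul_inv_cancel₀ hB.ne', mul_one,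
    ← mul_pow]
  norm_num

lemma scale_eq_exp {hbar : ℝ} (hh : 0 < hbar) (ε₀ : ℝ) {i : Fin (S.r + 1)} (hi : i ≠ 0) :
    hbar * (hbar ^ (-S.gam ε₀ i)) ^ 2 =
      Real.exp ((1 - S.lam i / lamMax A) * Real.log hbar) := by
  have h1 : (hbar ^ (-S.gam ε₀ i)) ^ 2 = hbar ^ (-(S.lam i / lamMax A)) := by
    rw [← Real.rpow_natCast, ← Real.rpow_mul hh.le, gam, if_neg hi]
    congr 1
    push_cast
    ring
  rw [h1, sub_mul, one_mul, sub_eq_add_neg, Real.exp_add, Real.exp_log hh,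
    Real.rpow_def_of_pos hh]
  ring_nf

lemma scale_le_one (hmax : 0 < lamMax A) {hbar : ℝ} (hh : 0 < hbar) (hh1 : hbar ≤ 1) (ε₀ : ℝ)
    {j : Fin d} (hj : j ∈ S.fastCoords) :
    hbar * (hbar ^ (-S.gam ε₀ (S.blockOf j))) ^ 2 ≤ 1 := by
  have hi := S.ne_zero_of_mem_fastBlocks hmax (Finset.mem_filter.1 hj).2
  rw [S.scale_eq_exp hh ε₀ hi, Real.exp_le_one_iff]
  refine mul_nonpos_of_nonneg_of_nonpos ?_ (Real.log_nonpos hh.le hh1)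
  rw [sub_nonneg, div_le_one hmax]
  exact S.lam_le_lamMax _ hi

/-- Here `q = λ_i/λ_max`, `ℓ = |log ħ|` and `L = λ_max`. The right side minus the left is `L + 2εqℓ
- (1-q)(ℓ - Ln)`; inserting `ℓ - Ln ≤ εℓ + L` leaves at least `qL + (3q-1)εℓ ≥ 0`. -/
lemma exponent_bound {q ε ℓ L n : ℝ} (hq : 1 / 2 ≤ q) (hq1 : q ≤ 1) (hε : 0 ≤ ε) (hℓ : 0 ≤ ℓ)
    (hL : 0 ≤ L) (hn : (1 - ε) * ℓ ≤ L * (n + 1)) :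
    (1 - q) * ℓ - q * L * n ≤ L + 2 * ε * q * ℓ - 2 * (q * L - L / 2) * n := by
  have h1 := mul_nonneg (sub_nonneg.2 hq1) (sub_nonneg.2 hn)
  have h2 : 0 ≤ (3 * q - 1) * (ε * ℓ) := mul_nonneg (by linarith) (mul_nonneg hε hℓ)
  have h3 : 0 ≤ q * L := mul_nonneg (by linarith) hL
  nlinarith

lemma inv_expansion_le (hmax : 0 < lamMax A) (ε₀ : ℝ) {ε δ : ℝ} (hε : 0 < ε) (hδ : 0 < δ)
    {hbar : ℝ} (hh : 0 < hbar) (hh1 : hbar ≤ 1) :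
    ((∏ j ∈ S.fastCoords, hbar * (hbar ^ (-S.gam ε₀ (S.blockOf j))) ^ 2) *
        |(S.expansion ^ nE A ε hbar).det|)⁻¹ ≤
      Real.exp (∑ i ∈ S.fastBlocks, (S.dim i : ℝ) * lamMax A) *
        (hbar ^ (-δ - ε * (S.LamPlus / lamMax A)) *
          Real.exp (-(S.rate * (nE A ε hbar : ℝ)))) ^ 2 := by
  set n := nE A ε hbar with hn
  set L := lamMax A with hL
  have hlog : Real.log hbar ≤ 0 := Real.log_nonpos hh.le hh1
  set ℓ := -Real.log hbar with hℓ
  have hℓ0 : 0 ≤ ℓ := neg_nonneg.2 hlog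
  -- The floor loses less than one unit of time; this is what produces the prefactor `exp(∑ d_i
  -- λ_max)`.
  have hnl : (1 - ε) * ℓ ≤ L * ((n : ℝ) + 1) := by
    have := (Nat.lt_floor_add_one ((1 - ε) * |Real.log hbar| / lamMax A)).le
    rw [abs_of_nonpos hlog, div_le_iff₀ hmax] at this
    rw [mul_comm L, hn, nE, abs_of_nonpos hlog]
    exact this
  have hprod : ∏ j ∈ S.fastCoords, hbar * (hbar ^ (-S.gam ε₀ (S.blockOf j))) ^ 2 =
      Real.exp (∑ i ∈ S.fastBlocks, (S.dim i : ℝ) * (-((1 - S.lam i / L) * ℓ))) := by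
    rw [S.prod_fastCoords fun i => hbar * (hbar ^ (-S.gam ε₀ i)) ^ 2, Real.exp_sum]
    refine Finset.prod_congr rfl fun i hi => ?_
    rw [S.scale_eq_exp hh ε₀ (S.ne_zero_of_mem_fastBlocks hmax hi), Real.exp_nat_mul, hℓ]
    congr 2
    ring
  have hdet : |(S.expansion ^ n).det| =
      Real.exp (n * ∑ i ∈ S.fastBlocks, (S.dim i : ℝ) * S.lam i) := by
    rw [Matrix.det_pow, abs_pow, S.abs_det_expansion hmax, ← Real.exp_nat_mul]
  rw [hprod, hdet, ← Real.exp_add, ← Real.exp_neg, Real.rpow_def_of_pos hh, ← Real.exp_add,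
    ← Real.exp_nat_mul, ← Real.exp_add]
  refine Real.exp_le_exp.2 ?_
  -- All exponents are nonnegative, so the loss over fast blocks is bounded by the full sum `Λ_+`.
  have hLam : ∑ i ∈ S.fastBlocks, (S.dim i : ℝ) * (S.lam i / L) ≤ S.LamPlus / L := by
    rw [LamPlus, Finset.sum_div]
    have h0 : ∀ i, 0 ≤ S.lam i := fun i => by
      rw [← S.lam_zero]
      exact S.lam_strictMono.monotone (Fin.zero_le i)
    refine (Finset.sum_le_sum_of_subset_of_nonneg (Finset.subset_univ S.fastBlocks)
      fun i _ _ => mul_nonneg (Nat.cast_nonneg _) (div_nonneg (h0 i) hmax.le)).trans_eq ?_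
    exact Finset.sum_congr rfl fun i _ => mul_div_assoc' _ _ _
  have hrate : S.rate = ∑ i ∈ S.fastBlocks, (S.dim i : ℝ) * (S.lam i - L / 2) := rfl
  have hmain : ∑ i ∈ S.fastBlocks, (S.dim i : ℝ) * ((1 - S.lam i / L) * ℓ - S.lam i * n) ≤
      ∑ i ∈ S.fastBlocks, (S.dim i : ℝ) *
        (L + 2 * ε * (S.lam i / L) * ℓ - 2 * (S.lam i - L / 2) * n) := by
    refine Finset.sum_le_sum fun i hi => mul_le_mul_of_nonneg_left ?_ (Nat.cast_nonneg _)
    have hi0 := S.ne_zero_of_mem_fastBlocks hmax hi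
    have hi1 : 0 < 2 * S.lam i - L := (Finset.mem_filter.1 hi).2
    have h := exponent_bound (q := S.lam i / L) (ε := ε) (ℓ := ℓ) (L := L) (n := n)
      (by rw [le_div_iff₀ hmax]; linarith)
      (by rw [div_le_one hmax]; exact S.lam_le_lamMax i hi0) hε.le hℓ0 hmax.le hnl
    rwa [div_mul_cancel₀ _ hmax.ne'] at h
  have e1 : ∑ i ∈ S.fastBlocks, (S.dim i : ℝ) * ((1 - S.lam i / L) * ℓ - S.lam i * n) =
      -(∑ i ∈ S.fastBlocks, (S.dim i : ℝ) * (-((1 - S.lam i / L) * ℓ)) +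
        n * ∑ i ∈ S.fastBlocks, (S.dim i : ℝ) * S.lam i) := by
    rw [Finset.mul_sum, ← Finset.sum_add_distrib, ← Finset.sum_neg_distrib]
    exact Finset.sum_congr rfl fun i _ => by ring
  have e2 : ∑ i ∈ S.fastBlocks, (S.dim i : ℝ) *
        (L + 2 * ε * (S.lam i / L) * ℓ - 2 * (S.lam i - L / 2) * n) =
      ∑ i ∈ S.fastBlocks, (S.dim i : ℝ) * L +
        2 * ε * ℓ * ∑ i ∈ S.fastBlocks, (S.dim i : ℝ) * (S.lam i / L) - 2 * (S.rate * n) := by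
    rw [hrate, Finset.sum_mul, Finset.mul_sum, Finset.mul_sum, ← Finset.sum_add_distrib,
      ← Finset.sum_sub_distrib]
    exact Finset.sum_congr rfl fun i _ => by ring
  rw [← e1]
  refine hmain.trans ?_
  rw [e2]
  have h5 : 2 * ε * ℓ * ∑ i ∈ S.fastBlocks, (S.dim i : ℝ) * (S.lam i / L) ≤
      2 * ε * ℓ * (S.LamPlus / L) := mul_le_mul_of_nonneg_left hLam (by positivity)
  -- The power `ħ^{-δ}` is pure slack in this estimate.
  have h6 : 0 ≤ δ * ℓ := mul_nonneg hδ.le hℓ0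
  have h7 : Real.log hbar = -ℓ := by rw [hℓ, neg_neg]
  rw [h7]
  push_cast
  nlinarith

/-- The overlap integral of the adapted Gaussians at time `n_E(ħ)`. -/
lemma exists_overlap_le (hmax : 0 < lamMax A) (ε₀ : ℝ) {ε δ : ℝ} (hε : 0 < ε) (hδ : 0 < δ) :
    ∃ C : ℝ, 0 ≤ C ∧ ∀ hbar : ℝ, 0 < hbar → hbar ≤ 1 →
      overlap (2 / hbar) (S.B ε₀ hbar) (A ^ nE A ε hbar) ≤
        ENNReal.ofReal (C * (hbar ^ (2 * d) * |(S.B ε₀ hbar).det| *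
          hbar ^ (-δ - ε * (S.LamPlus / lamMax A)) *
            Real.exp (-(S.rate * (nE A ε hbar : ℝ)))) ^ 2) := by
  obtain ⟨C, hC, h⟩ := CatMap.exists_overlap_le S.Q_mem
  refine ⟨C.toReal * Real.exp (∑ i ∈ S.fastBlocks, (S.dim i : ℝ) * lamMax A), by positivity,
    fun hbar hh hh1 => ?_⟩
  rw [S.pow_eq_core_pow]
  have hdet : (S.expansion ^ nE A ε hbar).det ≠ 0 := by
    rw [Matrix.det_pow]
    refine pow_ne_zero _ ?_
    rw [← abs_ne_zero, S.abs_det_expansion hmax]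
    exact (Real.exp_pos _).ne'
  refine (h hbar (fun j => hbar ^ (-S.gam ε₀ (S.blockOf j))) S.fastCoords _ _ hh
    (fun j => Real.rpow_pos_of_pos hh _) (fun j hj => S.scale_le_one hmax hh hh1 ε₀ hj)
    ((S.commute_doubleDiag_core fun i => hbar ^ (-S.gam ε₀ i)).pow_right _)
    (S.core_pow_mulVec_inl hmax _) (S.expansion_pow_mulVec_of_notMem _) hdet).trans ?_
  rw [← B_eq]
  conv_lhs => rw [← ENNReal.ofReal_toReal hC]
  rw [← ENNReal.ofReal_mul ENNReal.toReal_nonneg]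
  refine ENNReal.ofReal_le_ofReal ?_
  rw [mul_assoc C.toReal]
  refine mul_le_mul_of_nonneg_left ?_ ENNReal.toReal_nonneg
  refine (mul_le_mul_of_nonneg_left (S.inv_expansion_le hmax ε₀ hε hδ hh hh1)
    (by positivity)).trans_eq ?_
  rw [← sq_abs (S.B ε₀ hbar).det]
  ring

end OseledetsReduction

lemma lamMax_pos {A : Mat d ℝ} (h : ∃ β ∈ complexSpectrum A, 1 < ‖β‖) : 0 < lamMax A := by
  obtain ⟨β, hβ, h1⟩ := h
  exact (Real.log_pos h1).trans_le
    (le_csSup ((complexSpectrum_finite A).image _).bddAbove ⟨β, hβ, rfl⟩)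

lemma norm_le_of_enorm_sq_le {E : Type*} [SeminormedAddCommGroup E] {x : E} {C y : ℝ} (hC : 0 ≤ C)
    (hy : 0 ≤ y) (h : ‖x‖ₑ ^ 2 ≤ ENNReal.ofReal (C * y ^ 2)) : ‖x‖ ≤ √C * y := by
  rw [← ofReal_norm, ← ENNReal.ofReal_pow (norm_nonneg _),
    ENNReal.ofReal_le_ofReal_iff (by positivity)] at h
  refine (sq_le_sq₀ (norm_nonneg _) (by positivity)).1 ?_
  rwa [mul_pow, Real.sq_sqrt hC]

end CatMap

end

/-! ### Assembly of the norm bound. -/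

theorem proposition5p2 (d : ℕ) (Aint : CatMap.Mat d ℤ)
    (hA : Aint ∈ Matrix.symplecticGroup (Fin d) ℤ)
    (A : CatMap.Mat d ℝ) (hAA : A = Aint.map (fun m : ℤ => (m : ℝ)))
    (hone : (1 : ℂ) ∉ CatMap.complexSpectrum A)
    (hunst : ∃ β ∈ CatMap.complexSpectrum A, 1 < ‖β‖)
    (S : CatMap.OseledetsReduction A)
    (P M : ℕ → CatMap.Mat d ℝ) (hPM : CatMap.IsHalfPower A P M)
    (ε₀ : ℝ) (hε₀ : 0 < ε₀) (ε : ℝ) (hε : 0 < ε) (hε1 : ε < 1) (δ : ℝ) (hδ : 0 < δ) :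
    ∃ C : ℝ, ∀ hbar : ℝ, 0 < hbar → hbar ≤ 1 → ∀ ρ ρ' ρ₀ ρ₀' : CatMap.Phase d,
      ∃ Tplus Tminus : CatMap.L2 d →L[ℂ] CatMap.L2 d,
        CatMap.IsWeylQuantization hbar
          (S.symbol ε₀ hbar (P (CatMap.nE A ε hbar)) ρ ρ₀) Tplus ∧
        CatMap.IsWeylQuantization hbar
          (S.symbol ε₀ hbar (M (CatMap.nE A ε hbar)) ρ' ρ₀') Tminus ∧
        ‖Tplus ∘L ContinuousLinearMap.adjoint Tminus‖ ≤
          C * |(S.B ε₀ hbar).det| *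
            hbar ^ (-δ - ε * (S.LamPlus / CatMap.lamMax A)) *
            Real.exp (-(S.rate * (CatMap.nE A ε hbar : ℝ))) := by
  open CatMap in
  have hASp : A ∈ Matrix.symplecticGroup (Fin d) ℝ := by
    rw [hAA]
    exact SymplecticGroup.map_mem hA (Int.castRingHom ℝ)
  have hmax := lamMax_pos hunst
  obtain ⟨C, hC, hover⟩ := S.exists_overlap_le hmax ε₀ hε hδ
  refine ⟨(1 / Real.pi ^ d) ^ 2 * √C, fun hbar hh hh1 ρ ρ' ρ₀ ρ₀' => ?_⟩
  obtain ⟨hP, hM, hPeq⟩ := hPM.symplectic hASp (nE A ε hbar)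
  have hB : (S.B ε₀ hbar).det ≠ 0 := (S.det_B_pos hh ε₀).ne'
  have hcont : ∀ (X : Mat d ℝ) (σ σ₀ : Phase d),
      Continuous fun w : Phase d => 2 * Real.pi * ((X.mulVec w - σ₀) ⬝ᵥ σ) := fun X σ σ₀ =>
    continuous_const.mul (((Continuous.matrix_mulVec continuous_const continuous_id).sub
      continuous_const).dotProduct continuous_const)
  have hshift : ∀ (X : Mat d ℝ) (σ σ₀ w m : Phase d),
      2 * Real.pi * ((X.mulVec (w + m) - σ₀) ⬝ᵥ σ) =
        2 * Real.pi * ((X.mulVec w - σ₀) ⬝ᵥ σ) + 2 * Real.pi * (X.mulVec m ⬝ᵥ σ) := by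
    intro X σ σ₀ w m
    rw [Matrix.mulVec_add, add_sub_right_comm, add_dotProduct, mul_add]
  have hdet : ∀ {X : Mat d ℝ}, X ∈ Matrix.symplecticGroup (Fin d) ℝ →
      (S.B ε₀ hbar * X).det ≠ 0 := fun hX => by
    rw [Matrix.det_mul, SymplecticGroup.det_eq_one hX, mul_one]
    exact hB
  rw [S.symbol_eq_gaussSymbol, S.symbol_eq_gaussSymbol]
  have hf := integrable_gaussSymbol (S.gaussConst ε₀ hbar) (hdet hP)
    ((S.B ε₀ hbar).mulVec ((Real.pi * hbar) • (Matrix.J (Fin d) ℝ).mulVec ρ + ρ₀))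
    (hcont (P (nE A ε hbar)) ρ ρ₀)
  have hg := integrable_gaussSymbol (S.gaussConst ε₀ hbar) (hdet hM)
    ((S.B ε₀ hbar).mulVec ((Real.pi * hbar) • (Matrix.J (Fin d) ℝ).mulVec ρ' + ρ₀'))
    (hcont (M (nE A ε hbar)) ρ' ρ₀')
  refine ⟨weylOp hbar _ hf, weylOp hbar _ hg, isWeylQuantization_weylOp hbar hf,
    isWeylQuantization_weylOp hbar hg, ?_⟩
  have hnorm := norm_le_of_enorm_sq_le hC (by positivity)
    ((enorm_sq_superpose_gaussSymbol_le (2 / hbar) (S.gaussConst ε₀ hbar) hB hP hM hPeq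
      (S.gaussConst_sq_mul hh ε₀) _ _ (hshift (P (nE A ε hbar)) ρ ρ₀)
      (hshift (M (nE A ε hbar)) ρ' ρ₀') hf hg).trans (hover hbar hh hh1))
  rw [weylOp_comp_adjoint, norm_smul, Complex.norm_real, Real.norm_of_nonneg (by positivity)]
  refine (mul_le_mul_of_nonneg_left hnorm (by positivity)).trans_eq ?_
  -- The two prefactors `(πħ)^{-d}` cancel the `ħ^{2d}` from the rescaling, so the constant is
  -- uniform in `ħ`.
  have hpow : (1 / (Real.pi * hbar) ^ d) ^ 2 * hbar ^ (2 * d) = (1 / Real.pi ^ d) ^ 2 := by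
    rw [mul_pow, mul_comm 2 d, pow_mul]
    have := (pow_pos hh d).ne'
    field_simp
  rw [← hpow]
  ring
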